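/- Let $(M,g)$ be a smooth $4$-dimensional Lorentzian manifold of signature $(3,1)$ with Levi-Civita connection $\nabla$ and curvature $R(X,Y)Z=\nabla_X\nabla_YZ-\nabla_Y\nabla_XZ-\nabla_{[X,Y]}Z$, and let $V\subset M$ be a (smooth, embedded) lightlike hypersurface. An adapted frame is a smooth local frame $e_1,e_2,e_3,e_4$ such that, along $V$, the vectors $e_1,e_2,e_3$ are tangent to $V$ and the only nonzero scalar products are $g(e_1,e_4)=-1$ and $g(e_a,e_b)=\delta_{ab}$; here and below $a,b,c,d\in\{2,3\}$. Put $\lambda_{ab}=g(\nabla_{e_b}e_1,e_a)$, $\omega_1^1(v)=-g(\nabla_ve_1,e_4)$, $\omega_a^b(v)=g(\nabla_ve_a,e_b)$, and let $\lambda_2,\lambda_3$ be the eigenvalues of the shape operator $(\lambda_{ab})$; they are continuous and of weight one, that is, they are multiplied by $c$ when $e_1$ is replaced by $ce_1$. Suppose that everywhere on $V$ the eigenvalues $\lambda_2,\lambda_3$ are nonzero and distinct. In an adapted frame in which $(\lambda_{ab})=\operatorname{diag}(\lambda_2,\lambda_3)$ put $$K_a=\lambda_a-\frac{R_{1aa1}}{\lambda_a},\qquad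 K_{ab}=-\frac{\mu_{aab}}{\lambda_a},\qquad L_{ab}=\frac{K_{ab}}{\lambda_b-K_a},$$ where $R_{1aa1}=g(R(e_a,e_1)e_a,e_1)$ and $\mu_{abc}$ is the value on $e_c$ of the form $d\lambda_{ab}-\lambda_{ad}\omega_b^d-\lambda_{db}\omega_a^d-\lambda_{ab}\omega_1^1$ (summation over $d$). Suppose that everywhere on $V$ neither $K_2$ nor $K_3$ coincides with one of $\lambda_2,\lambda_3$, and that $K_2\neq K_3$, i.e. the coefficient $K_3-K_2$ of $\omega^1$ in $d\ln|\lambda_2/\lambda_3|$ does not vanish (in particular $\lambda_2/\lambda_3$ is not constant). Then $V$ carries three normalizations (each a smooth screen distribution, i.e. a smooth field of planes in the tangent spaces of $V$ complementary to the isotropic direction, together with a smooth field of isotropic lines transversal to $V$ and orthogonal to the screen) which are invariantly and intrinsically attached to $V$: * for $a=2$ and for $a=3$, a normalization whose screen is spanned by $e_2+L_{a2}e_1$ and $e_3+L_{a3}e_1$ in every adapted frame in which $(\lambda_{ab})=\operatorname{diag}(\lambda_2,\lambda_3)$, so that the screen does not depend on the frame; * a normalization whose screen is the kernel of the restriction of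 $d(\lambda_2/\lambda_3)$ to the tangent spaces of $V$. This screen distribution is integrable: through each point of $V$ there passes an integral surface of it. -/

import Mathlib

open Bundle Set Filter Topology
open scoped Manifold ContDiff

noncomputable section

/-- The model space of four-dimensional manifolds. -/
abbrev R4 : Type := EuclideanSpace ℝ (Fin 4)

namespace LightlikeGeometry

variable {M : Type*} [TopologicalSpace M] [ChartedSpace R4 M]

/-- Vector fields on `M`, without any regularity. A field that is only used on an open set may
take arbitrary values outside of it. -/
abbrev VField (M : Type*) [TopologicalSpace M] [ChartedSpace R4 M] : Type _ :=
  (x : M) → TangentSpace (𝓡 4) x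

variable [IsManifold (𝓡 4) ∞ M]

/-- The vector field `X` is differentiable at `x`. -/
abbrev DiffV (X : VField M) (x : M) : Prop :=
  MDifferentiableAt (𝓡 4) ((𝓡 4).prod 𝓘(ℝ, R4)) (fun y ↦ TotalSpace.mk' R4 y (X y)) x

variable (M) in
/-- A smooth metric of Lorentzian signature `(3, 1)` on a smooth four-dimensional manifold. -/
structure LorentzMetric where
  /-- The scalar product on the tangent spaces. -/
  val (x : M) : TangentSpace (𝓡 4) x →L[ℝ] TangentSpace (𝓡 4) x →L[ℝ] ℝ
  symm (x : M) (v w : TangentSpace (𝓡 4) x) : val x v w = val x w v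
  signature (x : M) : ∃ b : Module.Basis (Fin 4) ℝ (TangentSpace (𝓡 4) x),
    ∀ i j, val x (b i) (b j) = if i = j then (if i = 3 then -1 else 1) else 0
  contMDiff : ContMDiff (𝓡 4) ((𝓡 4).prod 𝓘(ℝ, R4 →L[ℝ] R4 →L[ℝ] ℝ)) ∞
    (fun x ↦ TotalSpace.mk' (R4 →L[ℝ] R4 →L[ℝ] ℝ)
      (E := fun x : M ↦ (TangentSpace (𝓡 4) x →L[ℝ] TangentSpace (𝓡 4) x →L[ℝ] ℝ)) x (val x))

variable (g : LorentzMetric M)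

/-! ### The Levi-Civita connection -/

/-- A covariant derivative is a Levi-Civita connection of `g` if it is torsion free and
compatible with `g`. -/
structure IsLeviCivita (g : LorentzMetric M)
    (cov : CovariantDerivative (𝓡 4) R4 (fun x : M ↦ TangentSpace (𝓡 4) x)) : Prop where
  torsion_free {X Y : VField M} {x : M} (hX : DiffV X x) (hY : DiffV Y x) :
    cov Y x (X x) - cov X x (Y x) = VectorField.mlieBracket (𝓡 4) X Y x
  metric {X Y : VField M} {x : M} (hX : DiffV X x) (hY : DiffV Y x)
    (v : TangentSpace (𝓡 4) x) :
    mvfderiv (𝓡 4) (fun y ↦ g.val y (X y) (Y y)) x v =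
      g.val x (cov X x v) (Y x) + g.val x (X x) (cov Y x v)

lemma LorentzMetric.nondeg (x : M) (v : TangentSpace (𝓡 4) x)
    (h : ∀ w, g.val x v w = 0) : v = 0 := by
  obtain ⟨b, hb⟩ := g.signature x
  have key : ∀ i, b.repr v i = 0 := by
    intro i
    have h1 := h (b i)
    rw [← b.sum_repr v] at h1
    simp only [map_sum, map_smul, sum_apply, smul_apply,
      hb, smul_eq_mul, mul_ite, mul_zero, Finset.sum_ite_eq', Finset.mem_univ, if_true] at h1
    split_ifs at h1 <;> linarith
  exact b.repr.injective (by ext i; simpa using key i)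

lemma LorentzMetric.mdiffAt {X Y : VField M} {x : M}
    (hX : DiffV X x) (hY : DiffV Y x) :
    MDifferentiableAt (𝓡 4) 𝓘(ℝ) (fun y ↦ g.val y (X y) (Y y)) x := by
  have : MDifferentiableAt (𝓡 4) ((𝓡 4).prod 𝓘(ℝ))
      (fun m ↦ TotalSpace.mk' ℝ (E := Bundle.Trivial M ℝ) m (g.val m (X m) (Y m))) x := by
    apply MDifferentiableAt.clm_bundle_apply₂ (F₁ := R4) (F₂ := R4)
    · exact g.contMDiff.contMDiffAt.mdifferentiableAt (by simp)
    · exact hX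
    · exact hY
  simp only [mdifferentiableAt_totalSpace] at this
  exact this.2

/-- The right hand side of the Koszul formula for `2 g(∇_X Y, Z)`. -/
def koszul (X Y Z : VField M) (x : M) : ℝ :=
  mvfderiv (𝓡 4) (fun y ↦ g.val y (Y y) (Z y)) x (X x)
  + mvfderiv (𝓡 4) (fun y ↦ g.val y (X y) (Z y)) x (Y x)
  - mvfderiv (𝓡 4) (fun y ↦ g.val y (X y) (Y y)) x (Z x)
  + g.val x (VectorField.mlieBracket (𝓡 4) X Y x) (Z x)
  - g.val x (VectorField.mlieBracket (𝓡 4) X Z x) (Y x)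
  - g.val x (VectorField.mlieBracket (𝓡 4) Y Z x) (X x)

variable {g} {X X' Y Y' Z Z' : VField M} {x : M} {f : M → ℝ}

lemma mvfderiv_val_add_left (hX : DiffV X x) (hX' : DiffV X' x)
    (hY : DiffV Y x) (v : TangentSpace (𝓡 4) x) :
    mvfderiv (𝓡 4) (fun y ↦ g.val y ((X + X') y) (Y y)) x v =
    mvfderiv (𝓡 4) (fun y ↦ g.val y (X y) (Y y)) x v
      + mvfderiv (𝓡 4) (fun y ↦ g.val y (X' y) (Y y)) x v := by
  have : (fun y ↦ g.val y ((X + X') y) (Y y)) =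
      (fun y ↦ g.val y (X y) (Y y)) + (fun y ↦ g.val y (X' y) (Y y)) := by
    ext y; simp
  rw [this, mvfderiv_add (g.mdiffAt hX hY) (g.mdiffAt hX' hY)]; rfl

lemma mvfderiv_val_smul_left (hf : MDifferentiableAt (𝓡 4) 𝓘(ℝ) f x) (hX : DiffV X x)
    (hY : DiffV Y x) (v : TangentSpace (𝓡 4) x) :
    mvfderiv (𝓡 4) (fun y ↦ g.val y ((f • X) y) (Y y)) x v =
    f x * mvfderiv (𝓡 4) (fun y ↦ g.val y (X y) (Y y)) x v
      + g.val x (X x) (Y x) * mvfderiv (𝓡 4) f x v := by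
  have : (fun y ↦ g.val y ((f • X) y) (Y y)) = f * (fun y ↦ g.val y (X y) (Y y)) := by
    ext y; simp
  rw [this, mvfderiv_mul hf (g.mdiffAt hX hY)]; rfl

lemma val_fun_comm (X Y : VField M) :
    (fun y ↦ g.val y (X y) (Y y)) = (fun y ↦ g.val y (Y y) (X y)) := by
  ext y; exact g.symm _ _ _

lemma koszul_add_left (hX : DiffV X x) (hX' : DiffV X' x)
    (hY : DiffV Y x) (hZ : DiffV Z x) :
    koszul g (X + X') Y Z x = koszul g X Y Z x + koszul g X' Y Z x := by
  unfold koszul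
  rw [mvfderiv_val_add_left hX hX' hY, mvfderiv_val_add_left hX hX' hZ,
    VectorField.mlieBracket_add_left hX hX', VectorField.mlieBracket_add_left hX hX']
  simp only [Pi.add_apply, map_add, add_apply]
  ring

lemma koszul_smul_left (hf : MDifferentiableAt (𝓡 4) 𝓘(ℝ) f x) (hX : DiffV X x)
    (hY : DiffV Y x) (hZ : DiffV Z x) :
    koszul g (f • X) Y Z x = f x * koszul g X Y Z x := by
  unfold koszul
  rw [mvfderiv_val_smul_left hf hX hY, mvfderiv_val_smul_left hf hX hZ,
    VectorField.mlieBracket_smul_left hf hX, VectorField.mlieBracket_smul_left hf hX]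
  simp only [Pi.smul_apply', map_add, map_smul, map_neg, neg_smul, add_apply, smul_apply,
    neg_apply, smul_eq_mul]
  ring

lemma koszul_add_right (hX : DiffV X x) (hY : DiffV Y x)
    (hZ : DiffV Z x) (hZ' : DiffV Z' x) :
    koszul g X Y (Z + Z') x = koszul g X Y Z x + koszul g X Y Z' x := by
  unfold koszul
  rw [val_fun_comm Y (Z + Z'), val_fun_comm X (Z + Z'),
    mvfderiv_val_add_left hZ hZ' hX, mvfderiv_val_add_left hZ hZ' hY,
    VectorField.mlieBracket_add_right hZ hZ', VectorField.mlieBracket_add_right hZ hZ',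
    val_fun_comm Z Y, val_fun_comm Z X, val_fun_comm Z' Y, val_fun_comm Z' X]
  simp only [Pi.add_apply, map_add, add_apply]
  ring

lemma koszul_smul_right (hf : MDifferentiableAt (𝓡 4) 𝓘(ℝ) f x) (hX : DiffV X x)
    (hY : DiffV Y x) (hZ : DiffV Z x) :
    koszul g X Y (f • Z) x = f x * koszul g X Y Z x := by
  unfold koszul
  rw [val_fun_comm Y (f • Z), val_fun_comm X (f • Z),
    mvfderiv_val_smul_left hf hZ hX, mvfderiv_val_smul_left hf hZ hY,
    VectorField.mlieBracket_smul_right hf hZ, VectorField.mlieBracket_smul_right hf hZ,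
    val_fun_comm Z Y, val_fun_comm Z X, g.symm x (Z x) (X x), g.symm x (Z x) (Y x)]
  simp only [Pi.smul_apply', map_add, map_smul, add_apply, smul_apply, smul_eq_mul]
  rw [g.symm x (Z x) (X x), g.symm x (Z x) (Y x)]
  ring

lemma koszul_add_mid (hX : DiffV X x) (hY : DiffV Y x)
    (hY' : DiffV Y' x) (hZ : DiffV Z x) :
    koszul g X (Y + Y') Z x = koszul g X Y Z x + koszul g X Y' Z x := by
  unfold koszul
  rw [val_fun_comm X (Y + Y'), mvfderiv_val_add_left hY hY' hX, mvfderiv_val_add_left hY hY' hZ,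
    VectorField.mlieBracket_add_right hY hY', VectorField.mlieBracket_add_left hY hY',
    val_fun_comm Y X, val_fun_comm Y' X]
  simp only [Pi.add_apply, map_add, add_apply]
  ring

lemma koszul_smul_mid (hf : MDifferentiableAt (𝓡 4) 𝓘(ℝ) f x) (hX : DiffV X x)
    (hY : DiffV Y x) (hZ : DiffV Z x) :
    koszul g X (f • Y) Z x = f x * koszul g X Y Z x
      + 2 * (mvfderiv (𝓡 4) f x (X x) * g.val x (Y x) (Z x)) := by
  unfold koszul
  rw [val_fun_comm X (f • Y), mvfderiv_val_smul_left hf hY hX, mvfderiv_val_smul_left hf hY hZ,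
    VectorField.mlieBracket_smul_right hf hY, VectorField.mlieBracket_smul_left hf hY,
    val_fun_comm Y X]
  simp only [Pi.smul_apply', map_add, map_smul, map_neg, neg_smul, add_apply, smul_apply,
    neg_apply, smul_eq_mul]
  ring

/-- The linear isomorphism `T_x M ≃ T_x^* M` induced by the metric. -/
def LorentzMetric.flat (g : LorentzMetric M) (x : M) :
    TangentSpace (𝓡 4) x ≃ₗ[ℝ] (TangentSpace (𝓡 4) x →L[ℝ] ℝ) :=
  haveI : FiniteDimensional ℝ (TangentSpace (𝓡 4) x) := inferInstanceAs (FiniteDimensional ℝ R4)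
  LinearEquiv.ofBijective
    ((g.val x : TangentSpace (𝓡 4) x →L[ℝ] (TangentSpace (𝓡 4) x →L[ℝ] ℝ)) :
      TangentSpace (𝓡 4) x →ₗ[ℝ] (TangentSpace (𝓡 4) x →L[ℝ] ℝ)) (by
    have hinj : Function.Injective ((g.val x :
        TangentSpace (𝓡 4) x →L[ℝ] (TangentSpace (𝓡 4) x →L[ℝ] ℝ)) :
        TangentSpace (𝓡 4) x →ₗ[ℝ] (TangentSpace (𝓡 4) x →L[ℝ] ℝ)) := by
      rw [injective_iff_map_eq_zero]
      intro v hv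
      exact g.nondeg x v fun w ↦ congrArg (fun φ : TangentSpace (𝓡 4) x →L[ℝ] ℝ ↦ φ w) hv
    refine ⟨hinj, ?_⟩
    have e : Module.finrank ℝ (TangentSpace (𝓡 4) x)
        = Module.finrank ℝ (TangentSpace (𝓡 4) x →L[ℝ] ℝ) := by
      have h1 : Module.finrank ℝ (R4 →ₗ[ℝ] ℝ) = Module.finrank ℝ (R4 →L[ℝ] ℝ) :=
        (LinearMap.toContinuousLinearMap (𝕜 := ℝ) (E := R4) (F' := ℝ)).finrank_eq
      exact (Subspace.dual_finrank_eq (K := ℝ) (V := R4)).symm.trans h1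
    exact (LinearMap.injective_iff_surjective_of_finrank_eq_finrank e).1 hinj)

lemma LorentzMetric.val_flat_symm (g : LorentzMetric M) (x : M)
    (φ : TangentSpace (𝓡 4) x →L[ℝ] ℝ) (w : TangentSpace (𝓡 4) x) :
    g.val x ((g.flat x).symm φ) w = φ w :=
  congrArg (fun ψ : TangentSpace (𝓡 4) x →L[ℝ] ℝ ↦ ψ w) ((g.flat x).apply_symm_apply φ)

lemma LorentzMetric.ext_val (g : LorentzMetric M) {v w : TangentSpace (𝓡 4) x}
    (h : ∀ u, g.val x v u = g.val x w u) : v = w :=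
  sub_eq_zero.1 (g.nondeg x _ fun u ↦ by simp [h u])

open Classical in
/-- `X, Z ↦ ½ koszul X Y Z` as a bilinear form on the tangent space at `x`. -/
def koszulForm (g : LorentzMetric M) (Y : VField M) (x : M) :
    TangentSpace (𝓡 4) x →L[ℝ] TangentSpace (𝓡 4) x →L[ℝ] ℝ :=
  if hY : DiffV Y x then
    TensorialAt.mkHom₂ (I := 𝓡 4) (F := R4) (F' := R4)
      (V := fun x : M ↦ TangentSpace (𝓡 4) x) (V' := fun x : M ↦ TangentSpace (𝓡 4) x)
      (fun X Z ↦ (1 / 2 : ℝ) * koszul g X Y Z x) x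
      (fun Z hZ ↦ ⟨fun hf hX ↦ by simp only [koszul_smul_left hf hX hY hZ, smul_eq_mul]; ring,
        fun hX hX' ↦ by simp only [koszul_add_left hX hX' hY hZ]; ring⟩)
      (fun X hX ↦ ⟨fun hf hZ ↦ by simp only [koszul_smul_right hf hX hY hZ, smul_eq_mul]; ring,
        fun hZ hZ' ↦ by simp only [koszul_add_right hX hY hZ hZ']; ring⟩)
  else 0

lemma koszulForm_apply (hX : DiffV X x) (hY : DiffV Y x)
    (hZ : DiffV Z x) :
    koszulForm g Y x (X x) (Z x) = (1 / 2 : ℝ) * koszul g X Y Z x := by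
  unfold koszulForm
  rw [dif_pos hY]
  exact TensorialAt.mkHom₂_apply (I := 𝓡 4) (F := R4) (F' := R4)
    (V := fun x : M ↦ TangentSpace (𝓡 4) x) (V' := fun x : M ↦ TangentSpace (𝓡 4) x) _ _ hX hZ

/-- Two bilinear forms agree if they agree on the values of differentiable vector fields. -/
lemma form_ext {A B : TangentSpace (𝓡 4) x →L[ℝ] TangentSpace (𝓡 4) x →L[ℝ] ℝ}
    (h : ∀ X Z : VField M, DiffV X x → DiffV Z x →
      A (X x) (Z x) = B (X x) (Z x)) : A = B := by
  ext v w
  have := h (FiberBundle.extend R4 v) (FiberBundle.extend R4 w)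
    (FiberBundle.mdifferentiableAt_extend ..)
    (FiberBundle.mdifferentiableAt_extend ..)
  simpa using this

lemma koszulForm_add (hY : DiffV Y x) (hY' : DiffV Y' x) :
    koszulForm g (Y + Y') x = koszulForm g Y x + koszulForm g Y' x := by
  refine form_ext fun X Z hX hZ ↦ ?_
  have h : DiffV (Y + Y') x := mdifferentiableAt_add_section hY hY'
  rw [add_apply, add_apply, koszulForm_apply hX h hZ, koszulForm_apply hX hY hZ,
    koszulForm_apply hX hY' hZ, koszul_add_mid hX hY hY' hZ]
  ring

lemma koszulForm_smul (hf : MDifferentiableAt (𝓡 4) 𝓘(ℝ) f x) (hY : DiffV Y x) :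
    koszulForm g (f • Y) x = f x • koszulForm g Y x
      + (mvfderiv (𝓡 4) f x).smulRight (g.val x (Y x)) := by
  refine form_ext fun X Z hX hZ ↦ ?_
  have h : DiffV (f • Y) x := hf.smul_section hY
  rw [add_apply, add_apply, koszulForm_apply hX h hZ, koszul_smul_mid hf hX hY hZ]
  simp only [smul_apply, ContinuousLinearMap.smulRight_apply, smul_eq_mul,
    koszulForm_apply hX hY hZ]
  ring

/-- The Levi-Civita connection of a Lorentzian metric, constructed from the Koszul formula:
`g(∇_v Y, w) = koszulForm g Y x v w`. -/
def leviCivita (g : LorentzMetric M) :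
    CovariantDerivative (𝓡 4) R4 (fun x : M ↦ TangentSpace (𝓡 4) x) where
  toFun Y x := LinearMap.toContinuousLinearMap (𝕜 := ℝ) (E := R4) (F' := R4)
    ((g.flat x).symm.toLinearMap ∘ₗ (koszulForm g Y x).toLinearMap)
  isCovariantDerivativeOnUniv :=
    { add := fun {Y Y' x} hY hY' _ ↦ by
        refine ContinuousLinearMap.ext fun (v : TangentSpace (𝓡 4) x) ↦ ?_
        change (g.flat x).symm (koszulForm g (Y + Y') x v)
          = (g.flat x).symm (koszulForm g Y x v) + (g.flat x).symm (koszulForm g Y' x v)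
        rw [koszulForm_add hY hY', add_apply, map_add]
      leibniz := fun {Y f x} hY hf _ ↦ by
        refine ContinuousLinearMap.ext fun (v : TangentSpace (𝓡 4) x) ↦ ?_
        change (g.flat x).symm (koszulForm g (f • Y) x v)
          = f x • (g.flat x).symm (koszulForm g Y x v) + mvfderiv (𝓡 4) f x v • Y x
        rw [koszulForm_smul hf hY]
        simp only [add_apply, smul_apply, ContinuousLinearMap.smulRight_apply, map_add, map_smul]
        congr 2
        exact (g.flat x).symm_apply_apply (Y x) }

lemma val_leviCivita (g : LorentzMetric M) (Y : VField M) (x : M)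
    (v w : TangentSpace (𝓡 4) x) :
    g.val x (leviCivita g Y x v) w = koszulForm g Y x v w :=
  g.val_flat_symm x _ w

/-- `leviCivita g` is torsion free and compatible with the metric. -/
theorem isLeviCivita_leviCivita (g : LorentzMetric M) : IsLeviCivita g (leviCivita g) where
  torsion_free {X Y x} hX hY := by
    refine g.ext_val fun u ↦ ?_
    have hE : DiffV (FiberBundle.extend R4 u) x := FiberBundle.mdifferentiableAt_extend ..
    have hu : (FiberBundle.extend R4 u : VField M) x = u := FiberBundle.extend_apply_self ..
    obtain ⟨Z, hZ, rfl⟩ : ∃ Z : VField M, DiffV Z x ∧ Z x = u := ⟨_, hE, hu⟩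
    rw [map_sub, sub_apply, val_leviCivita, val_leviCivita, koszulForm_apply hX hY hZ,
      koszulForm_apply hY hX hZ]
    unfold koszul
    rw [val_fun_comm Y X, VectorField.mlieBracket_swap_apply (V := Y) (W := X)]
    simp only [map_neg, neg_apply]
    ring
  metric {X Y x} hX hY v := by
    have hE : DiffV (FiberBundle.extend R4 v) x := FiberBundle.mdifferentiableAt_extend ..
    have hu : (FiberBundle.extend R4 v : VField M) x = v := FiberBundle.extend_apply_self ..
    obtain ⟨Z, hZ, rfl⟩ : ∃ Z : VField M, DiffV Z x ∧ Z x = v := ⟨_, hE, hu⟩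
    rw [g.symm x (X x), val_leviCivita, val_leviCivita, koszulForm_apply hZ hX hY,
      koszulForm_apply hZ hY hX]
    unfold koszul
    rw [val_fun_comm Y X, VectorField.mlieBracket_swap_apply (V := Y) (W := X)]
    simp only [map_neg, neg_apply]
    ring

/-- The curvature `R(X, Y) Z = ∇_X ∇_Y Z - ∇_Y ∇_X Z - ∇_[X, Y] Z`. -/
def curvature (g : LorentzMetric M) (X Y Z : VField M) (x : M) : TangentSpace (𝓡 4) x :=
  leviCivita g (fun y ↦ leviCivita g Z y (Y y)) x (X x)
    - leviCivita g (fun y ↦ leviCivita g Z y (X y)) x (Y x)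
    - leviCivita g Z x (VectorField.mlieBracket (𝓡 4) X Y x)

/-! ### Submanifolds, lightlike hypersurfaces, normalizations -/

/-- The vector field `X` is smooth on `U`. -/
abbrev SmoothV (X : VField M) (U : Set M) : Prop :=
  ContMDiffOn (𝓡 4) ((𝓡 4).prod 𝓘(ℝ, R4)) ∞ (fun y ↦ TotalSpace.mk' R4 y (X y)) U

/-- `W` is an embedded smooth submanifold of `M` of codimension `k`: locally it is the zero set
of a smooth map to `ℝ^k` whose differential is surjective at the points of `W`. -/
def IsSubmanifold (k : ℕ) (W : Set M) : Prop :=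
  ∀ x ∈ W, ∃ U : Set M, IsOpen U ∧ x ∈ U ∧ ∃ Φ : M → (Fin k → ℝ),
    ContMDiffOn (𝓡 4) 𝓘(ℝ, Fin k → ℝ) ∞ Φ U ∧ (∀ y ∈ U, y ∈ W ↔ Φ y = 0) ∧
    ∀ y ∈ U ∩ W, Function.Surjective (mvfderiv (𝓡 4) Φ y)

/-- The tangent space of `W ⊆ M` at `x`: the vectors that annihilate all smooth functions
vanishing on `W` near `x`. -/
def tangentSpaceOf (W : Set M) (x : M) : Submodule ℝ (TangentSpace (𝓡 4) x) where
  carrier := {v | ∀ f : M → ℝ, ContMDiffAt (𝓡 4) 𝓘(ℝ) ∞ f x → (∀ᶠ y in 𝓝[W] x, f y = 0) →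
    mvfderiv (𝓡 4) f x v = 0}
  add_mem' := fun hv hw f hf h0 ↦ by rw [map_add, hv f hf h0, hw f hf h0, add_zero]
  zero_mem' := fun f _ _ ↦ map_zero _
  smul_mem' := fun c v hv f hf h0 ↦ by rw [map_smul, hv f hf h0, smul_zero]

/-- The radical of the restriction of the metric to the tangent space `T_x V`. -/
def radical (g : LorentzMetric M) (V : Set M) (x : M) : Submodule ℝ (TangentSpace (𝓡 4) x) where
  carrier := {v | v ∈ tangentSpaceOf V x ∧ ∀ w ∈ tangentSpaceOf V x, g.val x v w = 0}
  add_mem' := fun hv hw ↦ ⟨add_mem hv.1 hw.1, fun u hu ↦ by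
    rw [map_add, add_apply, hv.2 u hu, hw.2 u hu, add_zero]⟩
  zero_mem' := ⟨zero_mem _, fun u _ ↦ by rw [map_zero, zero_apply]⟩
  smul_mem' := fun c v hv ↦ ⟨Submodule.smul_mem _ c hv.1, fun u hu ↦ by
    rw [map_smul, smul_apply, hv.2 u hu, smul_zero]⟩

/-- `V` is a lightlike hypersurface of `(M, g)`: the metric degenerates on its tangent spaces. -/
structure IsLightlikeHypersurface (g : LorentzMetric M) (V : Set M) : Prop where
  submanifold : IsSubmanifold 1 V
  degenerate : ∀ x ∈ V, radical g V x ≠ ⊥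

/-- A field of `k`-dimensional tangent subspaces of `M` along `V` that is smooth: locally
it is spanned by `k` smooth vector fields. -/
def SmoothAlong (k : ℕ) (V : Set M) (S : (x : M) → Submodule ℝ (TangentSpace (𝓡 4) x)) : Prop :=
  ∀ x ∈ V, Module.finrank ℝ (S x) = k ∧
    ∃ U : Set M, IsOpen U ∧ x ∈ U ∧ ∃ X : Fin k → VField M,
      (∀ a, SmoothV (X a) U) ∧ ∀ y ∈ U ∩ V, S y = Submodule.span ℝ (range fun a ↦ X a y)

/-- `S` is a screen distribution on the hypersurface `V`: a smooth field of planes in the tangent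
spaces of `V`, complementary to the radical (the isotropic direction). -/
structure IsScreenDistribution (g : LorentzMetric M) (V : Set M)
    (S : (x : M) → Submodule ℝ (TangentSpace (𝓡 4) x)) : Prop where
  smooth : SmoothAlong 2 V S
  inf_radical : ∀ x ∈ V, S x ⊓ radical g V x = ⊥
  sup_radical : ∀ x ∈ V, S x ⊔ radical g V x = tangentSpaceOf V x

/-- A normalization of `V`: a screen distribution `S` and a smooth field `N` of isotropic lines
that do not lie in the tangent spaces of `V` and are orthogonal to the screen. -/
structure IsNormalization (g : LorentzMetric M) (V : Set M)
    (S N : (x : M) → Submodule ℝ (TangentSpace (𝓡 4) x)) : Prop where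
  screen : IsScreenDistribution g V S
  smooth : SmoothAlong 1 V N
  isotropic : ∀ x ∈ V, ∀ v ∈ N x, g.val x v v = 0
  transversal : ∀ x ∈ V, N x ⊓ tangentSpaceOf V x = ⊥
  orthogonal : ∀ x ∈ V, ∀ v ∈ N x, ∀ w ∈ S x, g.val x v w = 0

/-- A distribution `S` of planes on `V` is integrable: through each point of `V` there passes
an integral surface of `S` in `V`. -/
def IsIntegrableOn (V : Set M) (S : (x : M) → Submodule ℝ (TangentSpace (𝓡 4) x)) : Prop :=
  ∀ x ∈ V, ∃ W : Set M, W ⊆ V ∧ x ∈ W ∧ IsSubmanifold 2 W ∧ ∀ y ∈ W, tangentSpaceOf W y = S y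

/-! ### Moving frames on a lightlike hypersurface -/

variable (M) in
/-- Four vector fields `e₁ = l`, `e₂ = s 0`, `e₃ = s 1`, `e₄ = n`. The indices `a, b, c = 2, 3`
become `0, 1 : Fin 2`. -/
structure Frame where
  /-- The isotropic tangent vector `e₁`. -/
  l : VField M
  /-- The vectors `e₂, e₃` that span the screen. -/
  s : Fin 2 → VField M
  /-- The isotropic transversal vector `e₄`. -/
  n : VField M

/-- `e` is a smooth frame on the open set `U` that is adapted to `V` along `U ∩ V`: the vectors
`e₁, e₂, e₃` are tangent to `V`, and `(e₁, e₄) = -1`, `(e_a, e_b) = δ_ab` are the only nonzero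
scalar products. -/
structure IsAdapted (g : LorentzMetric M) (V U : Set M) (e : Frame M) : Prop where
  isOpen : IsOpen U
  smooth_l : SmoothV e.l U
  smooth_s : ∀ a, SmoothV (e.s a) U
  smooth_n : SmoothV e.n U
  l_mem : ∀ x ∈ U ∩ V, e.l x ∈ tangentSpaceOf V x
  s_mem : ∀ x ∈ U ∩ V, ∀ a, e.s a x ∈ tangentSpaceOf V x
  l_l : ∀ x ∈ U ∩ V, g.val x (e.l x) (e.l x) = 0
  l_s : ∀ x ∈ U ∩ V, ∀ a, g.val x (e.l x) (e.s a x) = 0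
  l_n : ∀ x ∈ U ∩ V, g.val x (e.l x) (e.n x) = -1
  s_s : ∀ x ∈ U ∩ V, ∀ a b, g.val x (e.s a x) (e.s b x) = if a = b then 1 else 0
  s_n : ∀ x ∈ U ∩ V, ∀ a, g.val x (e.s a x) (e.n x) = 0
  n_n : ∀ x ∈ U ∩ V, g.val x (e.n x) (e.n x) = 0

/-- The connection form `ω₁¹(v)`, the `e₁`-component of `∇_v e₁`. -/
def omegaL (g : LorentzMetric M) (e : Frame M) (x : M) (v : TangentSpace (𝓡 4) x) : ℝ :=
  -g.val x (leviCivita g e.l x v) (e.n x)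

/-- The connection forms `ω_a^b(v)`, the `e_b`-component of `∇_v e_a`. -/
def omegaS (g : LorentzMetric M) (e : Frame M) (a b : Fin 2) (x : M)
    (v : TangentSpace (𝓡 4) x) : ℝ :=
  g.val x (leviCivita g (e.s a) x v) (e.s b x)

/-- The second fundamental tensor `λ_ab`, defined by `ω₁^a = λ_ab ω^b` on `V`. In an
adapted frame it is also the matrix of the shape operator `v ↦ ∇_v e₁` modulo `e₁`. -/
def secondForm (g : LorentzMetric M) (e : Frame M) (a b : Fin 2) (x : M) : ℝ :=
  g.val x (leviCivita g e.l x (e.s b x)) (e.s a x)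

/-- The coefficients `μ_abc` of `ω^c` in
`dλ_ab - λ_ad ω_b^d - λ_db ω_a^d - λ_ab ω₁¹`. -/
def mu (g : LorentzMetric M) (e : Frame M) (a b c : Fin 2) (x : M) : ℝ :=
  mvfderiv (𝓡 4) (secondForm g e a b) x (e.s c x)
    - ∑ d, secondForm g e a d x * omegaS g e b d x (e.s c x)
    - ∑ d, secondForm g e d b x * omegaS g e a d x (e.s c x)
    - secondForm g e a b x * omegaL g e x (e.s c x)

/-- The component `R_{1aa1}` of the curvature, for `R_{ijkl} = (R(e_k, e_l) e_j, e_i)`. -/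
def curv (g : LorentzMetric M) (e : Frame M) (a : Fin 2) (x : M) : ℝ :=
  g.val x (curvature g (e.s a) e.l (e.s a) x) (e.l x)

/-- `K_a = λ_a - R_{1aa1} / λ_a`. -/
def coeffK (g : LorentzMetric M) (e : Frame M) (a : Fin 2) (x : M) : ℝ :=
  secondForm g e a a x - curv g e a x / secondForm g e a a x

/-- `K_ab = -μ_aab / λ_a`. -/
def coeffKS (g : LorentzMetric M) (e : Frame M) (a b : Fin 2) (x : M) : ℝ :=
  -(mu g e a a b x / secondForm g e a a x)

/-- The normalizing object `L_ab`, the solution of `(λ_b - K_a) L_ab = K_ab`, in a frame in which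
`λ_ab` is diagonal. -/
def normalizingObject (g : LorentzMetric M) (e : Frame M) (a b : Fin 2) (x : M) : ℝ :=
  coeffKS g e a b x / (secondForm g e b b x - coeffK g e a x)

/-- `lam 0`, `lam 1` are the two eigenvalues `λ₂`, `λ₃` of the shape operator of `V`, as functions
of an isotropic vector `l` tangent to `V`: they are relative invariants of weight one, they are the
roots of the characteristic polynomial with multiplicities, and they are continuous. -/
structure IsEigenvaluePair (g : LorentzMetric M) (V : Set M)
    (lam : Fin 2 → (x : M) → TangentSpace (𝓡 4) x → ℝ) : Prop where
  smul : ∀ a, ∀ x ∈ V, ∀ l ∈ radical g V x, ∀ c : ℝ, lam a x (c • l) = c * lam a x l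
  charpoly : ∀ U e, IsAdapted g V U e → ∀ x ∈ U ∩ V,
    (Matrix.of fun a b ↦ secondForm g e a b x).charpoly =
      ∏ a, (Polynomial.X - Polynomial.C (lam a x (e.l x)))
  continuousOn : ∀ U e, IsAdapted g V U e → ∀ a,
    ContinuousOn (fun x ↦ lam a x (e.l x)) (U ∩ V)

/-- An adapted frame in which the second fundamental tensor is diagonal, with the eigenvalues
`λ₂`, `λ₃` in this order. -/
structure IsEigenframe (g : LorentzMetric M) (V : Set M)
    (lam : Fin 2 → (x : M) → TangentSpace (𝓡 4) x → ℝ) (U : Set M) (e : Frame M) : Prop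
    extends IsAdapted g V U e where
  diagonal : ∀ x ∈ U ∩ V, ∀ a b,
    secondForm g e a b x = if a = b then lam a x (e.l x) else 0

end LightlikeGeometry

end

open LightlikeGeometry

/-! Everything is extracted from the one-forms `d ln λ_a - ω₁¹` on `V`, where `λ_a` are the diagonal
entries of the second fundamental tensor in an eigenframe. Differentiating the orthogonality
relations of the frame along the isotropic direction and inserting the curvature gives a Riccati
equation `e₁(λ_a) = λ_a ω₁¹(e₁) + R_{1aa1} - λ_a²` (`IsAdapted.mvfderiv_secondForm_l`). Together
with the definition of `μ_aab` it says that the coefficients of `d ln λ_a - ω₁¹` on `e₁` and `e_b`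
are `-K_a` and `-K_ab` (`lnForm_l`, `lnForm_s`).

Since the eigenvalues are distinct, two eigenframes at a point are related by `e₁' = c e₁`, `e_b' =
ε_b e_b + t_b e₁` with `ε_b = ±1`. The coefficients then change by `λ_a' = c λ_a`, `K_a' = c K_a`
and `K_ab' = ε_b K_ab - t_b (λ_b - K_a)` (`IsEigenframe.exists_change`). Dividing by `λ_b - K_a`,
which does not vanish, gives `c L_ab' = ε_b L_ab - t_b`, so `e_b' + L_ab' e₁' = ε_b (e_b + L_ab e₁)`
and the spanned plane is the same for all eigenframes (`IsEigenframe.span_normalizingObject_eq`).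

The ratio `J = λ₂/λ₃` has weight zero, hence is a function on `V`. Here `ω₁¹` cancels and `dJ(e₁) =
J (K₃ - K₂) ≠ 0`, so the kernel of `dJ` on `T V` is complementary to `e₁`, and the level surfaces of
`J` integrate it (`IsEigenvalueRatio.mvfderiv_l_ne_zero`, `isIntegrableOn_ratioScreen`).

In all three cases the screen is locally spanned by `e_b + f_b e₁` with smooth `f_b`. Such a screen
has exactly one isotropic transversal line orthogonal to it, spanned by `e₄ + Σ f_b e_b + ½ Σ f_b²
e₁` (`IsAdapted.transversalOf_eq`, `isNormalization_of_local`).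

Two supports are needed. Smooth eigenframes exist near each point, by Gram–Schmidt, a smooth
rotation that diagonalizes, and continuity of the eigenvalues to fix their order
(`IsLightlikeHypersurface.exists_isEigenframe`). Frames satisfy their relations only along `V`, so
all differentiation is restricted to directions tangent to `V` (`mvfderiv_congr_of_tangent`). -/

noncomputable section

namespace LightlikeGeometry

variable {M : Type*} [TopologicalSpace M] [ChartedSpace R4 M] [IsManifold (𝓡 4) ∞ M]

/-! ### Smoothness of brackets, the Levi-Civita connection and curvature -/

section

/-- The function `f` is smooth on `U`. -/
abbrev SmoothF (f : M → ℝ) (U : Set M) : Prop := ContMDiffOn (𝓡 4) 𝓘(ℝ) ∞ f U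

variable {g : LorentzMetric M} {X Y Z : VField M} {U U' : Set M} {f : M → ℝ} {x : M}

lemma ofNat_le_infty {n : ℕ} [n.AtLeastTwo] : (OfNat.ofNat n : WithTop ℕ∞) ≤ ∞ :=
  WithTop.coe_le_coe.2 (le_top : ((OfNat.ofNat n : ℕ∞) ≤ ⊤))

lemma SmoothV.diffV (h : SmoothV X U) (hU : IsOpen U) (hx : x ∈ U) : DiffV X x :=
  (h.contMDiffAt (hU.mem_nhds hx)).mdifferentiableAt (by simp)

lemma SmoothF.mdiff (h : SmoothF f U) (hU : IsOpen U) (hx : x ∈ U) :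
    MDifferentiableAt (𝓡 4) 𝓘(ℝ) f x :=
  (h.contMDiffAt (hU.mem_nhds hx)).mdifferentiableAt (by simp)

lemma SmoothV.smul (hf : SmoothF f U) (hX : SmoothV X U) : SmoothV (fun y ↦ f y • X y) U :=
  ContMDiffOn.smul_section hf hX

lemma SmoothV.add (hX : SmoothV X U) (hY : SmoothV Y U) : SmoothV (fun y ↦ X y + Y y) U :=
  ContMDiffOn.add_section hX hY

lemma SmoothF.val (hX : SmoothV X U) (hY : SmoothV Y U) :
    SmoothF (fun y ↦ g.val y (X y) (Y y)) U := by
  have : ContMDiffOn (𝓡 4) ((𝓡 4).prod 𝓘(ℝ)) ∞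
      (fun m ↦ TotalSpace.mk' ℝ (E := Bundle.Trivial M ℝ) m (g.val m (X m) (Y m))) U :=
    ContMDiffOn.clm_bundle_apply₂ (F₁ := R4) (F₂ := R4) g.contMDiff.contMDiffOn hX hY
  intro y hy
  have := this y hy
  rw [contMDiffWithinAt_totalSpace] at this
  exact this.2

/-- The function is the fibre coordinate of the tangent map of `f` composed with the section `X`. -/
lemma SmoothF.mvfderiv (hf : SmoothF f U) (hX : SmoothV X U) (hU : IsOpen U) :
    SmoothF (fun y ↦ mvfderiv (𝓡 4) f y (X y)) U := by
  have : IsManifold (𝓡 4) 1 M := IsManifold.of_le (n := ∞) (by simp)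
  have h1 := ContMDiffOn.contMDiffOn_tangentMapWithin hf (m := ∞) (by simp) hU.uniqueMDiffOn
  have h2 := h1.comp hX (fun y hy ↦ hy)
  have h3 := (contMDiff_snd_tangentBundle_modelSpace ℝ 𝓘(ℝ)).comp_contMDiffOn h2
  refine h3.congr fun y hy ↦ ?_
  simp only [Function.comp, tangentMapWithin, mfderivWithin_of_isOpen hU hy]
  rfl

lemma SmoothV.mlieBracket (hX : SmoothV X U) (hY : SmoothV Y U) (hU : IsOpen U) :
    SmoothV (VectorField.mlieBracket (𝓡 4) X Y) U := by
  have : IsManifold (𝓡 4) ((((⊤ : ℕ∞) : WithTop ℕ∞)) + 1) M := by simpa using ‹IsManifold (𝓡 4) ∞ M›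
  have : IsManifold (𝓡 4) (minSmoothness ℝ 2) M :=
    IsManifold.of_le (n := ∞) (by simpa using ofNat_le_infty)
  intro y hy
  refine (ContMDiffAt.mlieBracket_vectorField (n := ⊤) (m := ⊤)
    (hX.contMDiffAt (hU.mem_nhds hy)) (hY.contMDiffAt (hU.mem_nhds hy)) ?_).contMDiffWithinAt
  simp

lemma SmoothF.koszul (hX : SmoothV X U) (hY : SmoothV Y U) (hZ : SmoothV Z U) (hU : IsOpen U) :
    SmoothF (koszul g X Y Z) U := by
  unfold LightlikeGeometry.koszul
  have h1 := SmoothF.mvfderiv (SmoothF.val (g := g) hY hZ) hX hU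
  have h2 := SmoothF.mvfderiv (SmoothF.val (g := g) hX hZ) hY hU
  have h3 := SmoothF.mvfderiv (SmoothF.val (g := g) hX hY) hZ hU
  have h4 := SmoothF.val (g := g) (SmoothV.mlieBracket hX hY hU) hZ
  have h5 := SmoothF.val (g := g) (SmoothV.mlieBracket hX hZ hU) hY
  have h6 := SmoothF.val (g := g) (SmoothV.mlieBracket hY hZ hU) hX
  exact ((((h1.add h2).sub h3).add h4).sub h5).sub h6

lemma SmoothF.sum {ι : Type*} {s : Finset ι} {f : ι → M → ℝ} (h : ∀ i ∈ s, SmoothF (f i) U) :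
    SmoothF (fun y ↦ ∑ i ∈ s, f i y) U := by
  have := contMDiffOn_finsetSum (f := f) h
  simpa using this

lemma SmoothF.prod {ι : Type*} {s : Finset ι} {f : ι → M → ℝ} (h : ∀ i ∈ s, SmoothF (f i) U) :
    SmoothF (fun y ↦ ∏ i ∈ s, f i y) U := by
  have := contMDiffOn_finsetProd (f := f) h
  simpa using this

lemma SmoothF.inv (hf : SmoothF f U) (h0 : ∀ y ∈ U, f y ≠ 0) : SmoothF (fun y ↦ (f y)⁻¹) U :=
  ContMDiffOn.inv₀ hf h0

lemma SmoothF.div {f' : M → ℝ} (hf : SmoothF f U) (hf' : SmoothF f' U)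
    (h0 : ∀ y ∈ U, f' y ≠ 0) : SmoothF (fun y ↦ f y / f' y) U :=
  ContMDiffOn.div₀ hf hf' h0

lemma SmoothF.det {n : Type*} [Fintype n] [DecidableEq n] {A : M → Matrix n n ℝ}
    (h : ∀ i j, SmoothF (fun y ↦ A y i j) U) : SmoothF (fun y ↦ (A y).det) U := by
  simp only [Matrix.det_apply']
  exact SmoothF.sum fun σ _ ↦ contMDiffOn_const.mul (SmoothF.prod fun i _ ↦ h _ _)

/-- A vector field is smooth if its scalar products with smooth vector fields are smooth. -/
lemma SmoothV.of_val {W : VField M} (hU : IsOpen U)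
    (h : ∀ (U' : Set M) (Z : VField M), IsOpen U' → U' ⊆ U → SmoothV Z U' →
      SmoothF (fun y ↦ g.val y (W y) (Z y)) U') : SmoothV W U := by
  intro x hx
  set e := trivializationAt R4 (TangentSpace (𝓡 4) : M → Type _) x with he
  set b := (EuclideanSpace.basisFun (Fin 4) ℝ).toBasis
  set U' := U ∩ e.baseSet
  have hU' : IsOpen U' := hU.inter e.open_baseSet
  have hxe : x ∈ e.baseSet := FiberBundle.mem_baseSet_trivializationAt' x
  have hxU' : x ∈ U' := ⟨hx, hxe⟩
  have hF : ∀ i, SmoothV (e.localFrame b i) U' := fun i ↦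
    (e.contMDiffOn_localFrame_baseSet ∞ b i).mono inter_subset_right
  let A : M → Matrix (Fin 4) (Fin 4) ℝ := fun y ↦
    Matrix.of fun i j ↦ g.val y (e.localFrame b j y) (e.localFrame b i y)
  let φ : M → Fin 4 → ℝ := fun y i ↦ g.val y (W y) (e.localFrame b i y)
  let c : M → Fin 4 → ℝ := fun y i ↦ e.localFrameCoeff (𝓡 4) b i y (W y)
  have hA : ∀ i j, SmoothF (fun y ↦ A y i j) U' := fun i j ↦ SmoothF.val (hF j) (hF i)
  have hφ : ∀ i, SmoothF (fun y ↦ φ y i) U' := fun i ↦ h U' _ hU' inter_subset_left (hF i)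
  have hW : ∀ y ∈ U', W y = ∑ i, c y i • e.localFrame b i y := fun y hy ↦
    Bundle.Trivialization.eq_sum_localFrameCoeff_smul hy.2
  -- The coefficients of `W` solve a linear system with the Gram matrix of the local frame. Both
  -- sides of the system are smooth, and nondegeneracy of the metric makes the determinant nonzero,
  -- so Cramer's rule gives smooth coefficients.
  have hsys : ∀ y ∈ U', (A y).mulVec (c y) = φ y := by
    intro y hy
    ext i
    simp only [Matrix.mulVec, dotProduct, A, φ, Matrix.of_apply]
    conv_rhs => rw [hW y hy]
    simp [mul_comm]
  have hdet : ∀ y ∈ U', (A y).det ≠ 0 := by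
    intro y hy h0
    obtain ⟨v, hv0, hv⟩ := Matrix.exists_mulVec_eq_zero_iff.2 h0
    apply hv0
    have hb : ∀ i, e.localFrame b i y = e.basisAt b hy.2 i := fun i ↦
      e.localFrame_apply_of_mem_baseSet b hy.2
    have hz : ∑ i, v i • e.localFrame b i y = 0 := by
      refine g.nondeg y _ fun w ↦ ?_
      rw [← (e.basisAt b hy.2).sum_repr w]
      simp only [← hb, map_sum, map_smul]
      refine Finset.sum_eq_zero fun i _ ↦ ?_
      have := congrFun hv i
      simp only [Matrix.mulVec, dotProduct, A, Matrix.of_apply, Pi.zero_apply] at this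
      simp only [sum_apply, smul_apply, smul_eq_mul]
      rw [Finset.sum_congr rfl fun j _ ↦ mul_comm (v j) _, this, mul_zero]
    simp only [hb] at hz
    have := Fintype.linearIndependent_iff.1 (e.basisAt b hy.2).linearIndependent v hz
    exact funext this
  have hc : ∀ i, SmoothF (fun y ↦ c y i) U' := by
    intro i
    have h1 : SmoothF (fun y ↦ (((A y).updateCol i (φ y)).det) / (A y).det) U' := by
      refine SmoothF.div (SmoothF.det fun j k ↦ ?_) (SmoothF.det hA) hdet
      by_cases hk : k = i
      · subst hk; simpa using hφ j
      · simpa [Matrix.updateCol_ne hk] using hA j k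
    refine h1.congr fun y hy ↦ ?_
    rw [eq_div_iff (hdet y hy), ← Matrix.cramer_apply, ← hsys y hy, Matrix.cramer_eq_adjugate_mulVec,
      Matrix.mulVec_mulVec, Matrix.adjugate_mul, Matrix.smul_mulVec, Matrix.one_mulVec]
    simp [mul_comm]
  have : ContMDiffAt (𝓡 4) ((𝓡 4).prod 𝓘(ℝ, R4)) ∞ (fun y ↦ TotalSpace.mk' R4 y (W y)) x :=
    (contMDiffAt_iff_localFrameCoeff b hxe).2 fun i ↦
      (hc i).contMDiffAt (hU'.mem_nhds hxU')
  exact this.contMDiffWithinAt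

/-- The connection is built pointwise from the Koszul formula, so its smoothness is not automatic.
Its scalar products with smooth fields are half of Koszul expressions, which are smooth, and that
suffices. -/
lemma SmoothV.leviCivita (hX : SmoothV X U) (hY : SmoothV Y U) (hU : IsOpen U) :
    SmoothV (fun y ↦ leviCivita g X y (Y y)) U := by
  refine SmoothV.of_val (g := g) hU fun U' Z hU' hsub hZ ↦ ?_
  have h1 := (SmoothF.koszul (g := g) (hY.mono hsub) (hX.mono hsub) hZ hU')
  have h2 : SmoothF (fun y ↦ (1 / 2 : ℝ) * koszul g Y X Z y) U' := contMDiffOn_const.mul h1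
  refine h2.congr fun y hy ↦ ?_
  rw [val_leviCivita, koszulForm_apply (SmoothV.diffV hY hU (hsub hy))
    (SmoothV.diffV hX hU (hsub hy)) (SmoothV.diffV hZ hU' hy)]

lemma SmoothV.curvature (hX : SmoothV X U) (hY : SmoothV Y U) (hZ : SmoothV Z U) (hU : IsOpen U) :
    SmoothV (curvature g X Y Z) U := by
  have h1 := SmoothV.leviCivita (g := g) (SmoothV.leviCivita (g := g) hZ hY hU) hX hU
  have h2 := SmoothV.leviCivita (g := g) (SmoothV.leviCivita (g := g) hZ hX hU) hY hU
  have h3 := SmoothV.leviCivita (g := g) hZ (SmoothV.mlieBracket hX hY hU) hU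
  exact ContMDiffOn.sub_section (ContMDiffOn.sub_section h1 h2) h3

/-- Every tangent vector is the value of a vector field that is smooth in a neighbourhood. -/
lemma exists_smoothV (x : M) (v : TangentSpace (𝓡 4) x) :
    ∃ (U : Set M) (X : VField M), IsOpen U ∧ x ∈ U ∧ SmoothV X U ∧ X x = v := by
  obtain ⟨s, hs, h⟩ := FiberBundle.exists_contMDiffOn_extend (𝓡 4) R4 (k := ∞) v
  obtain ⟨U, hUs, hU, hxU⟩ := mem_nhds_iff.1 hs
  exact ⟨U, FiberBundle.extend R4 v, hU, hxU, h.mono hUs, FiberBundle.extend_apply_self ..⟩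

/-- The Lie bracket acts on functions as the commutator. -/
lemma mvfderiv_mlieBracket (hf : SmoothF f U) (hX : SmoothV X U) (hY : SmoothV Y U)
    (hU : IsOpen U) (hx : x ∈ U) :
    mvfderiv (𝓡 4) f x (VectorField.mlieBracket (𝓡 4) X Y x) =
      mvfderiv (𝓡 4) (fun y ↦ mvfderiv (𝓡 4) f y (Y y)) x (X x)
        - mvfderiv (𝓡 4) (fun y ↦ mvfderiv (𝓡 4) f y (X y)) x (Y x) := by
  have : Nontrivial R4 := inferInstance
  -- The identity is deduced from the Jacobi identity for `X`, `Y` and `f Z`, where `Z` is an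
  -- auxiliary field that does not vanish at `x`.
  obtain ⟨v, hv⟩ : ∃ v : R4, v ≠ 0 := exists_ne 0
  obtain ⟨U', Z, hU', hxU', hZ, hZx⟩ := exists_smoothV x (v : TangentSpace (𝓡 4) x)
  have hZ0 : Z x ≠ 0 := by rw [hZx]; exact hv
  have : IsManifold (𝓡 4) (minSmoothness ℝ 3) M :=
    IsManifold.of_le (n := ∞) (by simpa using ofNat_le_infty)
  let O := U ∩ U'
  have hO : IsOpen O := hU.inter hU'
  have hxO : x ∈ O := ⟨hx, hxU'⟩
  replace hf : SmoothF f O := hf.mono inter_subset_left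
  replace hX : SmoothV X O := hX.mono inter_subset_left
  replace hY : SmoothV Y O := hY.mono inter_subset_left
  replace hZ : SmoothV Z O := hZ.mono inter_subset_right
  have at2 : ∀ {W : VField M}, SmoothV W O → ContMDiffAt (𝓡 4) ((𝓡 4).prod 𝓘(ℝ, R4))
      (minSmoothness ℝ 2) (fun y ↦ TotalSpace.mk' R4 y (W y)) x := fun hW ↦
    (hW.contMDiffAt (hO.mem_nhds hxO)).of_le
      (by simpa using ofNat_le_infty)
  have hfZ : SmoothV (f • Z) O := SmoothV.smul hf hZ
  -- the iterated bracket `[P, [Q, f Z]]`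
  have key : ∀ {P Q : VField M}, SmoothV P O → SmoothV Q O →
      VectorField.mlieBracket (𝓡 4) P (VectorField.mlieBracket (𝓡 4) Q (f • Z)) x =
      mvfderiv (𝓡 4) (fun y ↦ mvfderiv (𝓡 4) f y (Q y)) x (P x) • Z x
      + mvfderiv (𝓡 4) f x (Q x) • VectorField.mlieBracket (𝓡 4) P Z x
      + (mvfderiv (𝓡 4) f x (P x) • VectorField.mlieBracket (𝓡 4) Q Z x
      + f x • VectorField.mlieBracket (𝓡 4) P (VectorField.mlieBracket (𝓡 4) Q Z) x) := by
    intro P Q hP hQ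
    have e1 : VectorField.mlieBracket (𝓡 4) Q (f • Z) =ᶠ[𝓝 x]
        (fun y ↦ mvfderiv (𝓡 4) f y (Q y)) • Z + f • VectorField.mlieBracket (𝓡 4) Q Z := by
      filter_upwards [hO.mem_nhds hxO] with y hy
      exact VectorField.mlieBracket_smul_right (SmoothF.mdiff hf hO hy) (SmoothV.diffV hZ hO hy)
    have s1 : SmoothF (fun y ↦ mvfderiv (𝓡 4) f y (Q y)) O := SmoothF.mvfderiv hf hQ hO
    have s2 : SmoothV (VectorField.mlieBracket (𝓡 4) Q Z) O := SmoothV.mlieBracket hQ hZ hO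
    have d1 : DiffV ((fun y ↦ mvfderiv (𝓡 4) f y (Q y)) • Z) x :=
      SmoothV.diffV (SmoothV.smul s1 hZ) hO hxO
    have d2 : DiffV (f • VectorField.mlieBracket (𝓡 4) Q Z) x :=
      SmoothV.diffV (SmoothV.smul hf s2) hO hxO
    rw [Filter.EventuallyEq.mlieBracket_vectorField_eq (EventuallyEq.refl (𝓝 x) P) e1,
      VectorField.mlieBracket_add_right d1 d2,
      VectorField.mlieBracket_smul_right (SmoothF.mdiff s1 hO hxO) (SmoothV.diffV hZ hO hxO),
      VectorField.mlieBracket_smul_right (SmoothF.mdiff hf hO hxO) (SmoothV.diffV s2 hO hxO)]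
  have j1 := VectorField.leibniz_identity_mlieBracket_apply (at2 hX) (at2 hY) (at2 hfZ)
  have j2 := VectorField.leibniz_identity_mlieBracket_apply (at2 hX) (at2 hY) (at2 hZ)
  rw [key hX hY, key hY hX, j2, VectorField.mlieBracket_smul_right (SmoothF.mdiff hf hO hxO)
    (SmoothV.diffV hZ hO hxO)] at j1
  -- After removing `f` times the Jacobi identity for `X`, `Y`, `Z`, the terms with brackets of `Z`
  -- cancel in pairs. What remains is the claimed identity multiplied by `Z x`.
  have j3 : (mvfderiv (𝓡 4) f x (VectorField.mlieBracket (𝓡 4) X Y x) -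
      (mvfderiv (𝓡 4) (fun y ↦ mvfderiv (𝓡 4) f y (Y y)) x (X x)
        - mvfderiv (𝓡 4) (fun y ↦ mvfderiv (𝓡 4) f y (X y)) x (Y x))) • Z x = 0 := by
    rw [sub_smul, sub_smul]
    rw [smul_add] at j1
    generalize mvfderiv (𝓡 4) f x (VectorField.mlieBracket (𝓡 4) X Y x) • Z x = a at *
    generalize mvfderiv (𝓡 4) (fun y ↦ mvfderiv (𝓡 4) f y (Y y)) x (X x) • Z x = b at *
    generalize mvfderiv (𝓡 4) (fun y ↦ mvfderiv (𝓡 4) f y (X y)) x (Y x) • Z x = c at *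
    generalize mvfderiv (𝓡 4) f x (Y x) • VectorField.mlieBracket (𝓡 4) X Z x = d at *
    generalize mvfderiv (𝓡 4) f x (X x) • VectorField.mlieBracket (𝓡 4) Y Z x = d' at *
    have : a + c = b := by
      refine add_right_cancel (b := d + d' + f x • VectorField.mlieBracket (𝓡 4)
        (VectorField.mlieBracket (𝓡 4) X Y) Z x + f x • VectorField.mlieBracket (𝓡 4) Y
        (VectorField.mlieBracket (𝓡 4) X Z) x) ?_
      rw [← add_assoc, ← add_assoc] at *
      convert j1.symm using 1 <;> abel
    rw [← this]; abel
  exact sub_eq_zero.1 ((smul_eq_zero.1 j3).resolve_right hZ0)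

end

/-! ### Tangent spaces of submanifolds and differentiation along a hypersurface -/

section

variable {g : LorentzMetric M} {X Y Z : VField M} {U V W : Set M} {f f' : M → ℝ} {x : M}

section Submanifolds

variable {k : ℕ} {Φ : M → (Fin k → ℝ)}

lemma mvfderiv_component (hΦ : MDifferentiableAt (𝓡 4) 𝓘(ℝ, Fin k → ℝ) Φ x) (i : Fin k)
    (v : TangentSpace (𝓡 4) x) :
    mvfderiv (𝓡 4) (fun y ↦ Φ y i) x v = mvfderiv (𝓡 4) Φ x v i := by
  have h1 : HasMFDerivAt 𝓘(ℝ, Fin k → ℝ) 𝓘(ℝ) (fun p : Fin k → ℝ ↦ p i) (Φ x)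
      (ContinuousLinearMap.proj (R := ℝ) (φ := fun _ : Fin k ↦ ℝ) i) :=
    (ContinuousLinearMap.proj (R := ℝ) (φ := fun _ : Fin k ↦ ℝ) i).hasMFDerivAt
  have h2 := (h1.comp x hΦ.hasMFDerivAt).mfderiv
  exact congrArg (fun A : TangentSpace (𝓡 4) x →L[ℝ] ℝ ↦ A v) h2

/-- The tangent space of a submanifold given by an equation is the kernel of the differential. -/
lemma mem_tangentSpaceOf_iff (hU : IsOpen U)
    (hΦ : ContMDiffOn (𝓡 4) 𝓘(ℝ, Fin k → ℝ) ∞ Φ U) (hW : ∀ y ∈ U, y ∈ W ↔ Φ y = 0)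
    (hsurj : Function.Surjective (mvfderiv (𝓡 4) Φ x)) (hx : x ∈ U) (hxW : x ∈ W)
    (v : TangentSpace (𝓡 4) x) :
    v ∈ tangentSpaceOf W x ↔ mvfderiv (𝓡 4) Φ x v = 0 := by
  have hΦx : ContMDiffAt (𝓡 4) 𝓘(ℝ, Fin k → ℝ) ∞ Φ x := hΦ.contMDiffAt (hU.mem_nhds hx)
  have hΦd := hΦx.mdifferentiableAt (by simp)
  constructor
  · intro hv
    ext i
    rw [← mvfderiv_component hΦd]
    refine hv _ ?_ ?_
    · exact (contMDiffAt_pi_space.1 hΦx) i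
    · filter_upwards [mem_nhdsWithin_of_mem_nhds (hU.mem_nhds hx), self_mem_nhdsWithin] with y hy hyW
      rw [(hW y hy).1 hyW]; rfl
  · intro hv f hf hf0
    have hfd := hf.mdifferentiableAt (by simp)
    rw [hfd.mvfderiv]
    rw [hΦd.mvfderiv] at hv hsurj
    have c1 := (contMDiffAt_iff.1 hf).2
    have c2 := (contMDiffAt_iff.1 hΦx).2
    simp only [modelWithCornersSelf_coe, range_id, fderivWithin_univ, contDiffWithinAt_univ] at c1 c2 hv hsurj ⊢
    have d1 := c1.hasStrictFDerivAt (by simp)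
    have d2 := c2.hasStrictFDerivAt (by simp)
    set F := ((extChartAt 𝓘(ℝ) (f x)) ∘ f ∘ (extChartAt (𝓡 4) x).symm) with hF
    set G := ((extChartAt 𝓘(ℝ, Fin k → ℝ) (Φ x)) ∘ Φ ∘ (extChartAt (𝓡 4) x).symm) with hG
    have e0 : (extChartAt (𝓡 4) x).symm (extChartAt (𝓡 4) x x) = x := extChartAt_to_inv x
    -- In the chart, `f` is constant on the level set of `Φ`, so the point is trivially a
    -- constrained extremum. The Lagrange multiplier rule then makes `df` a combination of the
    -- components of `dΦ`.
    have hext : IsLocalExtrOn F {w | G w = G (extChartAt (𝓡 4) x x)} (extChartAt (𝓡 4) x x) := by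
      left
      have hct : Tendsto (extChartAt (𝓡 4) x).symm (𝓝 (extChartAt (𝓡 4) x x)) (𝓝 x) := by
        have := (continuousAt_extChartAt_symm (I := 𝓡 4) x).tendsto
        rwa [e0] at this
      have h1 := hct.eventually (hU.mem_nhds hx)
      have h2 := hct.eventually (eventually_nhdsWithin_iff.1 hf0)
      filter_upwards [mem_nhdsWithin_of_mem_nhds h1, mem_nhdsWithin_of_mem_nhds h2,
        self_mem_nhdsWithin] with w hw1 hw2 hw3
      have h3 : (extChartAt (𝓡 4) x).symm w ∈ W := by
        rw [hW _ hw1]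
        have h4 : Φ ((extChartAt (𝓡 4) x).symm w)
          = Φ ((extChartAt (𝓡 4) x).symm (extChartAt (𝓡 4) x x)) := hw3
        rw [h4, e0]
        exact (hW x hx).1 hxW
      have h5 : f x = 0 := (mem_of_mem_nhds (eventually_nhdsWithin_iff.1 hf0)) hxW
      have hFw : F w = 0 := hw2 h3
      have hFx : F (extChartAt (𝓡 4) x x) = 0 := (congrArg f e0).trans h5
      exact hFx.le.trans hFw.ge
    obtain ⟨Λ, Λ₀, h0, hL⟩ := hext.exists_linear_map_of_hasStrictFDerivAt d2 d1
    -- A vanishing multiplier of `df` would give `Λ ∘ dΦ = 0`, hence `Λ = 0` by surjectivity of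
    -- `dΦ`, against the nontriviality of the multipliers.
    by_cases h : Λ₀ = 0
    · exfalso
      apply h0
      rw [Prod.mk_eq_zero]
      refine ⟨LinearMap.ext fun p ↦ ?_, h⟩
      obtain ⟨u, rfl⟩ := hsurj p
      have := hL u
      simp only [h, zero_smul, add_zero] at this
      exact this
    · have := hL v
      have hv' : (fderiv ℝ G (extChartAt (𝓡 4) x x)) v = 0 := hv
      rw [hv', map_zero, zero_add] at this
      exact (smul_eq_zero.1 this).resolve_left h

end Submanifolds

/-- A hypersurface is locally given by one equation with a nonvanishing differential, the kernel of
which is the tangent space. -/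
lemma IsSubmanifold.exists_equation (hV : IsSubmanifold 1 V) (hx : x ∈ V) :
    ∃ (U : Set M) (F : M → ℝ), IsOpen U ∧ x ∈ U ∧ SmoothF F U ∧ (∀ y ∈ U, y ∈ V ↔ F y = 0) ∧
      ∀ y ∈ U ∩ V, (∃ v, mvfderiv (𝓡 4) F y v ≠ 0) ∧
        ∀ v, v ∈ tangentSpaceOf V y ↔ mvfderiv (𝓡 4) F y v = 0 := by
  obtain ⟨U, hU, hxU, Φ, hΦ, hVU, hs⟩ := hV x hx
  have hc : ∀ y ∈ U, ∀ v : TangentSpace (𝓡 4) y,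
      mvfderiv (𝓡 4) (fun y ↦ Φ y 0) y v = mvfderiv (𝓡 4) Φ y v 0 := fun y hy v ↦
    mvfderiv_component ((hΦ.contMDiffAt (hU.mem_nhds hy)).mdifferentiableAt (by simp)) 0 v
  refine ⟨U, fun y ↦ Φ y 0, hU, hxU, (contMDiffOn_pi_space.1 hΦ) 0, fun y hy ↦ ?_, fun y hy ↦
    ⟨?_, fun v ↦ ?_⟩⟩
  · rw [hVU y hy, funext_iff, Fin.forall_fin_one]; rfl
  · obtain ⟨v, hv⟩ := hs y hy 1
    refine ⟨v, ?_⟩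
    rw [hc y hy.1, hv]
    simp
  · rw [hc y hy.1, mem_tangentSpaceOf_iff hU hΦ hVU (hs y hy) hy.1 hy.2, funext_iff,
      Fin.forall_fin_one]
    rfl

/-- Functions that agree on `V` have the same derivatives in the directions tangent to `V`. -/
lemma mvfderiv_congr_of_tangent (hU : IsOpen U) (hf : SmoothF f U) (hf' : SmoothF f' U)
    (h : ∀ y ∈ U ∩ V, f y = f' y) (hx : x ∈ U) {v : TangentSpace (𝓡 4) x}
    (hv : v ∈ tangentSpaceOf V x) : mvfderiv (𝓡 4) f x v = mvfderiv (𝓡 4) f' x v := by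
  have h1 := hv (f - f') ((hf.sub hf').contMDiffAt (hU.mem_nhds hx)) (by
    filter_upwards [mem_nhdsWithin_of_mem_nhds (hU.mem_nhds hx), self_mem_nhdsWithin] with y hy hyV
    simp [h y ⟨hy, hyV⟩])
  rw [mvfderiv_sub (SmoothF.mdiff hf hU hx) (SmoothF.mdiff hf' hU hx)] at h1
  exact sub_eq_zero.1 h1

/-- The product rule for a scalar product that is known along `V`. -/
lemma val_leviCivita_add (hU : IsOpen U) (hX : SmoothV X U) (hY : SmoothV Y U) (hf : SmoothF f U)
    (h : ∀ y ∈ U ∩ V, g.val y (X y) (Y y) = f y) (hx : x ∈ U) {v : TangentSpace (𝓡 4) x}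
    (hv : v ∈ tangentSpaceOf V x) :
    g.val x (leviCivita g X x v) (Y x) + g.val x (X x) (leviCivita g Y x v) =
      mvfderiv (𝓡 4) f x v := by
  rw [← (isLeviCivita_leviCivita g).metric (SmoothV.diffV hX hU hx) (SmoothV.diffV hY hU hx) v]
  exact mvfderiv_congr_of_tangent hU (SmoothF.val hX hY) hf h hx hv

lemma val_leviCivita_add_of_const (c : ℝ) (hU : IsOpen U) (hX : SmoothV X U) (hY : SmoothV Y U)
    (h : ∀ y ∈ U ∩ V, g.val y (X y) (Y y) = c) (hx : x ∈ U) {v : TangentSpace (𝓡 4) x}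
    (hv : v ∈ tangentSpaceOf V x) :
    g.val x (leviCivita g X x v) (Y x) + g.val x (X x) (leviCivita g Y x v) = 0 := by
  rw [val_leviCivita_add (f := fun _ ↦ c) hU hX hY contMDiffOn_const h hx hv, mvfderiv_const]
  rfl

/-- The covariant derivative in a direction tangent to `V` only depends on the field along `V`. -/
lemma leviCivita_congr_of_tangent (hU : IsOpen U) (hX : SmoothV X U) (hY : SmoothV Y U)
    (h : ∀ y ∈ U ∩ V, X y = Y y) (hx : x ∈ U) (hxV : x ∈ V) {v : TangentSpace (𝓡 4) x}
    (hv : v ∈ tangentSpaceOf V x) : leviCivita g X x v = leviCivita g Y x v := by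
  refine g.ext_val fun u ↦ ?_
  obtain ⟨U', Z, hU', hxU', hZ, rfl⟩ := exists_smoothV x u
  have hO := hU.inter hU'
  replace hX : SmoothV X (U ∩ U') := hX.mono inter_subset_left
  replace hY : SmoothV Y (U ∩ U') := hY.mono inter_subset_left
  replace hZ : SmoothV Z (U ∩ U') := hZ.mono inter_subset_right
  have e1 := (isLeviCivita_leviCivita g).metric (SmoothV.diffV hY hO ⟨hx, hxU'⟩)
    (SmoothV.diffV hZ hO ⟨hx, hxU'⟩) v
  have e2 := val_leviCivita_add (g := g) (V := V) hO hX hZ (SmoothF.val hY hZ)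
    (fun y hy ↦ by rw [h y ⟨hy.1.1, hy.2⟩]) ⟨hx, hxU'⟩ hv
  rw [e1, h x ⟨hx, hxV⟩] at e2
  exact add_right_cancel e2

/-- The Lie bracket of vector fields tangent to a hypersurface is tangent to it. -/
lemma mlieBracket_mem_tangentSpaceOf (hV : IsSubmanifold 1 V) (hU : IsOpen U) (hX : SmoothV X U)
    (hY : SmoothV Y U) (hXt : ∀ y ∈ U ∩ V, X y ∈ tangentSpaceOf V y)
    (hYt : ∀ y ∈ U ∩ V, Y y ∈ tangentSpaceOf V y) (hx : x ∈ U ∩ V) :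
    VectorField.mlieBracket (𝓡 4) X Y x ∈ tangentSpaceOf V x := by
  obtain ⟨U', F, hU', hxU', hF, -, hT⟩ := hV.exists_equation hx.2
  have hO := hU.inter hU'
  have hxO : x ∈ U ∩ U' := ⟨hx.1, hxU'⟩
  replace hX : SmoothV X (U ∩ U') := hX.mono inter_subset_left
  replace hY : SmoothV Y (U ∩ U') := hY.mono inter_subset_left
  replace hF : SmoothF F (U ∩ U') := hF.mono inter_subset_right
  rw [(hT x ⟨hxU', hx.2⟩).2, mvfderiv_mlieBracket hF hX hY hO hxO]
  -- The functions `Y F` and `X F` vanish along `V`, so their derivatives in the tangent directions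
  -- `X` and `Y` vanish, and so does `[X, Y] F`.
  have e1 := mvfderiv_congr_of_tangent (V := V) (f' := fun _ ↦ (0 : ℝ)) hO
    (SmoothF.mvfderiv hF hY hO) contMDiffOn_const (fun y hy ↦
      ((hT y ⟨hy.1.2, hy.2⟩).2 _).1 (hYt y ⟨hy.1.1, hy.2⟩)) hxO (hXt x hx)
  have e2 := mvfderiv_congr_of_tangent (V := V) (f' := fun _ ↦ (0 : ℝ)) hO
    (SmoothF.mvfderiv hF hX hO) contMDiffOn_const (fun y hy ↦
      ((hT y ⟨hy.1.2, hy.2⟩).2 _).1 (hXt y ⟨hy.1.1, hy.2⟩)) hxO (hYt x hx)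
  rw [e1, e2, mvfderiv_const]
  exact sub_zero 0

end

/-! ### Adapted frames and the derivative equations of the second fundamental tensor -/

section

variable {g : LorentzMetric M} {X Y Z : VField M} {U V W : Set M} {e : Frame M} {x : M}

namespace IsAdapted

lemma mono (he : IsAdapted g V U e) {U' : Set M} (hU' : IsOpen U') (h : U' ⊆ U) :
    IsAdapted g V U' e where
  isOpen := hU'
  smooth_l := he.smooth_l.mono h
  smooth_s a := (he.smooth_s a).mono h
  smooth_n := he.smooth_n.mono h
  l_mem x hx := he.l_mem x ⟨h hx.1, hx.2⟩
  s_mem x hx := he.s_mem x ⟨h hx.1, hx.2⟩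
  l_l x hx := he.l_l x ⟨h hx.1, hx.2⟩
  l_s x hx := he.l_s x ⟨h hx.1, hx.2⟩
  l_n x hx := he.l_n x ⟨h hx.1, hx.2⟩
  s_s x hx := he.s_s x ⟨h hx.1, hx.2⟩
  s_n x hx := he.s_n x ⟨h hx.1, hx.2⟩
  n_n x hx := he.n_n x ⟨h hx.1, hx.2⟩

lemma s_l (he : IsAdapted g V U e) (hx : x ∈ U ∩ V) (a : Fin 2) :
    g.val x (e.s a x) (e.l x) = 0 := by rw [g.symm, he.l_s x hx]

lemma n_l (he : IsAdapted g V U e) (hx : x ∈ U ∩ V) :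
    g.val x (e.n x) (e.l x) = -1 := by rw [g.symm, he.l_n x hx]

lemma n_s (he : IsAdapted g V U e) (hx : x ∈ U ∩ V) (a : Fin 2) :
    g.val x (e.n x) (e.s a x) = 0 := by rw [g.symm, he.s_n x hx]

/-- The expansion of a tangent vector of `M` in an adapted frame. -/
lemma expand (he : IsAdapted g V U e) (hx : x ∈ U ∩ V) (v : TangentSpace (𝓡 4) x) :
    v = (-g.val x v (e.n x)) • e.l x + ∑ a, g.val x v (e.s a x) • e.s a x
      + (-g.val x v (e.l x)) • e.n x := by
  have hfin : FiniteDimensional ℝ (TangentSpace (𝓡 4) x) :=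
    inferInstanceAs (FiniteDimensional ℝ R4)
  let E : Fin 4 → TangentSpace (𝓡 4) x := ![e.l x, e.s 0 x, e.s 1 x, e.n x]
  -- Pairing a linear relation with each of the four vectors kills the coefficients, because the
  -- Gram matrix of an adapted frame is invertible. Four independent vectors span.
  have hli : LinearIndependent ℝ E := by
    rw [Fintype.linearIndependent_iff]
    intro c hc
    simp only [E, Fin.sum_univ_four, Matrix.cons_val_zero, Matrix.cons_val_one,
      Matrix.cons_val] at hc
    have pair : ∀ w, c 0 * g.val x (e.l x) w + c 1 * g.val x (e.s 0 x) w
        + c 2 * g.val x (e.s 1 x) w + c 3 * g.val x (e.n x) w = 0 := by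
      intro w
      have := congrArg (fun u ↦ g.val x u w) hc
      simpa only [map_add, map_smul, add_apply, smul_apply, smul_eq_mul, map_zero,
        zero_apply] using this
    have p0 := pair (e.l x)
    have p1 := pair (e.s 0 x)
    have p2 := pair (e.s 1 x)
    have p3 := pair (e.n x)
    simp only [he.l_l x hx, he.l_s x hx, he.l_n x hx, he.s_s x hx, he.s_n x hx, he.n_n x hx,
      he.s_l hx, he.n_l hx, he.n_s hx] at p0 p1 p2 p3
    simp at p0 p1 p2 p3
    intro i
    fin_cases i <;> simp [p0, p1, p2, p3]
  have hspan := hli.span_eq_top_of_card_eq_finrank (by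
    rw [Fintype.card_fin]
    exact (finrank_euclideanSpace_fin (𝕜 := ℝ) (n := 4)).symm)
  refine g.ext_val fun u ↦ ?_
  rw [g.symm x v, g.symm x _ u]
  have hu : u ∈ Submodule.span ℝ (range E) := hspan ▸ Submodule.mem_top
  induction hu using Submodule.span_induction with
  | mem u hu =>
    obtain ⟨i, rfl⟩ := hu
    rw [g.symm x _ v, g.symm x (E i)]
    fin_cases i <;>
    simp [E, he.l_l x hx, he.l_s x hx, he.l_n x hx, he.s_s x hx, he.s_n x hx, he.n_n x hx,
      he.s_l hx, he.n_l hx, he.n_s hx]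
  | zero => rw [map_zero, zero_apply, zero_apply]
  | add u w _ _ h1 h2 => rw [map_add, add_apply, add_apply, h1, h2]
  | smul c u _ h => rw [map_smul, smul_apply, smul_apply, h]

/-- A tangent vector not orthogonal to `e₁` has a nonzero `e₄`-component, so `e₄` would be tangent
along with `e₁, e₂, e₃`. Then every vector would be tangent, although the differential of a defining
equation is nonzero. -/
lemma mem_tangent_iff (hV : IsSubmanifold 1 V) (he : IsAdapted g V U e) (hx : x ∈ U ∩ V)
    (v : TangentSpace (𝓡 4) x) : v ∈ tangentSpaceOf V x ↔ g.val x v (e.l x) = 0 := by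
  have hls : ∀ v : TangentSpace (𝓡 4) x,
      (-g.val x v (e.n x)) • e.l x + ∑ a, g.val x v (e.s a x) • e.s a x ∈ tangentSpaceOf V x :=
    fun v ↦ add_mem (Submodule.smul_mem _ _ (he.l_mem x hx))
      (Submodule.sum_mem _ fun a _ ↦ Submodule.smul_mem _ _ (he.s_mem x hx a))
  constructor
  · intro hv
    by_contra h
    have hn : e.n x ∈ tangentSpaceOf V x := by
      have h1 := he.expand hx v
      have h2 := sub_mem hv (hls v)
      nth_rewrite 1 [h1] at h2
      rw [add_sub_cancel_left] at h2
      exact (Submodule.smul_mem_iff _ (neg_ne_zero.2 h)).1 h2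
    obtain ⟨U', F, -, hxU', -, -, hT⟩ := hV.exists_equation hx.2
    obtain ⟨⟨w, hw⟩, hT⟩ := hT x ⟨hxU', hx.2⟩
    apply hw
    rw [← hT, he.expand hx w]
    exact add_mem (hls w) (Submodule.smul_mem _ _ hn)
  · intro hv
    rw [he.expand hx v, hv, neg_zero, zero_smul, add_zero]
    exact hls v

lemma expand_tangent (hV : IsSubmanifold 1 V) (he : IsAdapted g V U e) (hx : x ∈ U ∩ V)
    {v : TangentSpace (𝓡 4) x} (hv : v ∈ tangentSpaceOf V x) :
    v = (-g.val x v (e.n x)) • e.l x + ∑ a, g.val x v (e.s a x) • e.s a x := by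
  have := he.expand hx v
  rwa [(he.mem_tangent_iff hV hx v).1 hv, neg_zero, zero_smul, add_zero] at this

lemma l_ne_zero (he : IsAdapted g V U e) (hx : x ∈ U ∩ V) : e.l x ≠ 0 := by
  intro h
  have := he.l_n x hx
  rw [h, map_zero, zero_apply] at this
  norm_num at this

lemma l_mem_radical (hV : IsSubmanifold 1 V) (he : IsAdapted g V U e) (hx : x ∈ U ∩ V) :
    e.l x ∈ radical g V x :=
  ⟨he.l_mem x hx, fun w hw ↦ by rw [g.symm, (he.mem_tangent_iff hV hx w).1 hw]⟩

lemma radical_eq (hV : IsSubmanifold 1 V) (he : IsAdapted g V U e) (hx : x ∈ U ∩ V) :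
    radical g V x = Submodule.span ℝ {e.l x} := by
  apply le_antisymm
  · rintro v ⟨hv, hv'⟩
    have := he.expand_tangent hV hx hv
    simp only [hv' _ (he.s_mem x hx _), zero_smul, Finset.sum_const_zero, add_zero] at this
    rw [this]
    exact Submodule.smul_mem _ _ (Submodule.mem_span_singleton_self _)
  · rw [Submodule.span_singleton_le_iff_mem]
    exact he.l_mem_radical hV hx

section Derivatives

variable {v : TangentSpace (𝓡 4) x}

lemma val_cov_l_l (he : IsAdapted g V U e) (hx : x ∈ U ∩ V) (hv : v ∈ tangentSpaceOf V x) :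
    g.val x (leviCivita g e.l x v) (e.l x) = 0 := by
  have := val_leviCivita_add_of_const 0 he.isOpen he.smooth_l he.smooth_l he.l_l hx.1 hv
  rw [g.symm x (e.l x)] at this
  linarith

lemma val_cov_s_l (he : IsAdapted g V U e) (hx : x ∈ U ∩ V) (hv : v ∈ tangentSpaceOf V x)
    (a : Fin 2) :
    g.val x (leviCivita g (e.s a) x v) (e.l x) = -g.val x (leviCivita g e.l x v) (e.s a x) := by
  have := val_leviCivita_add_of_const 0 he.isOpen he.smooth_l (he.smooth_s a)
    (fun y hy ↦ he.l_s y hy a) hx.1 hv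
  rw [g.symm x (e.l x)] at this
  linarith

lemma omegaS_self (he : IsAdapted g V U e) (hx : x ∈ U ∩ V) (hv : v ∈ tangentSpaceOf V x)
    (a : Fin 2) : omegaS g e a a x v = 0 := by
  have := val_leviCivita_add_of_const 1 he.isOpen (he.smooth_s a) (he.smooth_s a)
    (fun y hy ↦ by rw [he.s_s y hy, if_pos rfl]) hx.1 hv
  rw [g.symm x (e.s a x)] at this
  unfold omegaS
  linarith

/-- The second derivatives `∇_X Y` of tangent fields along `V` are symmetric modulo `V`. -/
lemma val_cov_comm (hV : IsSubmanifold 1 V) (he : IsAdapted g V U e) (hx : x ∈ U ∩ V)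
    (hX : SmoothV X U) (hY : SmoothV Y U) (hXt : ∀ y ∈ U ∩ V, X y ∈ tangentSpaceOf V y)
    (hYt : ∀ y ∈ U ∩ V, Y y ∈ tangentSpaceOf V y) :
    g.val x (leviCivita g Y x (X x)) (e.l x) = g.val x (leviCivita g X x (Y x)) (e.l x) := by
  have h1 := (he.mem_tangent_iff hV hx _).1
    (mlieBracket_mem_tangentSpaceOf hV he.isOpen hX hY hXt hYt hx)
  rw [← (isLeviCivita_leviCivita g).torsion_free (SmoothV.diffV hX he.isOpen hx.1)
    (SmoothV.diffV hY he.isOpen hx.1), map_sub, sub_apply] at h1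
  exact sub_eq_zero.1 h1

/-- The bracket of two screen fields is tangent to `V`, hence orthogonal to `e₁`; moving the
derivatives onto `e₁` turns this into symmetry. -/
lemma secondForm_symm (hV : IsSubmanifold 1 V) (he : IsAdapted g V U e) (hx : x ∈ U ∩ V)
    (a b : Fin 2) : secondForm g e a b x = secondForm g e b a x := by
  have h1 := he.val_cov_comm hV hx (he.smooth_s a) (he.smooth_s b) (fun y hy ↦ he.s_mem y hy a)
    (fun y hy ↦ he.s_mem y hy b)
  rw [he.val_cov_s_l hx (he.s_mem x hx a), he.val_cov_s_l hx (he.s_mem x hx b)] at h1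
  unfold secondForm
  linarith

/-- Same argument with the bracket of `e₁` and `e_a`: it moves the derivative to `g(∇_{e_a} e₁,
e₁)`, which vanishes since `e₁` is isotropic along `V`. -/
lemma val_cov_l_l_s (hV : IsSubmanifold 1 V) (he : IsAdapted g V U e) (hx : x ∈ U ∩ V)
    (a : Fin 2) : g.val x (leviCivita g e.l x (e.l x)) (e.s a x) = 0 := by
  have h1 := he.val_cov_comm hV hx he.smooth_l (he.smooth_s a) he.l_mem
    (fun y hy ↦ he.s_mem y hy a)
  rw [he.val_cov_s_l hx (he.l_mem x hx), he.val_cov_l_l hx (he.s_mem x hx a)] at h1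
  linarith

/-- The integral curves of the isotropic field are geodesics. -/
lemma cov_l_l (hV : IsSubmanifold 1 V) (he : IsAdapted g V U e) (hx : x ∈ U ∩ V) :
    leviCivita g e.l x (e.l x) = omegaL g e x (e.l x) • e.l x := by
  have ht : leviCivita g e.l x (e.l x) ∈ tangentSpaceOf V x :=
    (he.mem_tangent_iff hV hx _).2 (he.val_cov_l_l hx (he.l_mem x hx))
  have := he.expand_tangent hV hx ht
  rw [Finset.sum_eq_zero fun a _ ↦ by rw [he.val_cov_l_l_s hV hx, zero_smul], add_zero] at this
  exact this

lemma val_cov_l_s (hV : IsSubmanifold 1 V) (he : IsAdapted g V U e) (hx : x ∈ U ∩ V)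
    (hv : v ∈ tangentSpaceOf V x) (a : Fin 2) :
    g.val x (leviCivita g e.l x v) (e.s a x) =
      ∑ b, secondForm g e a b x * g.val x v (e.s b x) := by
  conv_lhs => rw [he.expand_tangent hV hx hv]
  simp only [map_add, map_smul, map_sum, add_apply, smul_apply, sum_apply, smul_eq_mul,
    he.val_cov_l_l_s hV hx, mul_zero, zero_add]
  exact Finset.sum_congr rfl fun b _ ↦ mul_comm _ _

lemma smoothF_secondForm (he : IsAdapted g V U e) (a b : Fin 2) :
    SmoothF (secondForm g e a b) U :=
  SmoothF.val (SmoothV.leviCivita he.smooth_l (he.smooth_s b) he.isOpen) (he.smooth_s a)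

/-- The covariant derivative of the second fundamental tensor in the isotropic direction. -/
lemma mvfderiv_secondForm_l (hV : IsSubmanifold 1 V) (he : IsAdapted g V U e) (hx : x ∈ U ∩ V)
    (a : Fin 2) (hd : ∀ b, b ≠ a → secondForm g e a b x = 0) :
    mvfderiv (𝓡 4) (secondForm g e a a) x (e.l x) =
      secondForm g e a a x * omegaL g e x (e.l x) + curv g e a x - secondForm g e a a x ^ 2 := by
  have hA : SmoothV (fun y ↦ leviCivita g (e.s a) y (e.l y)) U :=
    SmoothV.leviCivita (he.smooth_s a) he.smooth_l he.isOpen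
  have hB : SmoothV (fun y ↦ leviCivita g (e.s a) y (e.s a y)) U :=
    SmoothV.leviCivita (he.smooth_s a) (he.smooth_s a) he.isOpen
  -- The two second covariant derivatives in `R(e_a, e₁) e_a` are paired with `e₁` by
  -- differentiating known functions on `V`: first `g(∇_{e₁} e_a, e₁) = 0` along `e_a`, then
  -- `g(∇_{e_a} e_a, e₁) = -λ_aa` along `e₁`.
  have h1 := val_leviCivita_add_of_const 0 he.isOpen hA he.smooth_l (fun y hy ↦ by
    rw [he.val_cov_s_l hy (he.l_mem y hy), he.val_cov_l_l_s hV hy, neg_zero]) hx.1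
    (he.s_mem x hx a)
  have h2 := val_leviCivita_add (f := -secondForm g e a a) he.isOpen hB he.smooth_l
    (he.smoothF_secondForm a a).neg (fun y hy ↦ he.val_cov_s_l hy (he.s_mem y hy a) a) hx.1
    (he.l_mem x hx)
  rw [he.cov_l_l hV hx, map_smul, he.val_cov_s_l hx (he.s_mem x hx a), mvfderiv_neg] at h2
  have hw := mlieBracket_mem_tangentSpaceOf hV he.isOpen (he.smooth_s a) he.smooth_l
    (fun y hy ↦ he.s_mem y hy a) he.l_mem hx
  have hsum : ∀ u : TangentSpace (𝓡 4) x, ∑ b, secondForm g e a b x * g.val x u (e.s b x) =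
      secondForm g e a a x * g.val x u (e.s a x) := fun u ↦
    Finset.sum_eq_single a (fun b _ hb ↦ by rw [hd b hb, zero_mul]) (by simp)
  -- The bracket term is the source of `λ_a²`: one factor comes from the shape operator applied to
  -- `[e_a, e₁]`, the other from the `e_a`-component of `[e_a, e₁] = ∇_{e_a} e₁ - ∇_{e₁} e_a`, whose
  -- second summand has no `e_a`-component.
  have h3 : g.val x (leviCivita g (e.s a) x (VectorField.mlieBracket (𝓡 4) (e.s a) e.l x))
      (e.l x) = -(secondForm g e a a x * secondForm g e a a x) := by
    rw [he.val_cov_s_l hx hw, he.val_cov_l_s hV hx hw, hsum,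
      ← (isLeviCivita_leviCivita g).torsion_free (SmoothV.diffV (he.smooth_s a) he.isOpen hx.1)
      (SmoothV.diffV he.smooth_l he.isOpen hx.1), map_sub, sub_apply]
    have := he.omegaS_self hx (he.l_mem x hx) a
    unfold omegaS at this
    rw [this, sub_zero]
    rfl
  -- Modulo `e₁` the second vector is `λ_a e_a`, and `∇_{e₁} e_a` is orthogonal to both `e₁` and
  -- `e_a`.
  have h4 : g.val x (leviCivita g (e.s a) x (e.l x)) (leviCivita g e.l x (e.s a x)) = 0 := by
    have ht : leviCivita g e.l x (e.s a x) ∈ tangentSpaceOf V x :=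
      (he.mem_tangent_iff hV hx _).2 (he.val_cov_l_l hx (he.s_mem x hx a))
    rw [he.expand_tangent hV hx ht]
    simp only [map_add, map_sum, map_smul, smul_eq_mul]
    rw [he.val_cov_s_l hx (he.l_mem x hx), he.val_cov_l_l_s hV hx, neg_zero, mul_zero, zero_add]
    refine Finset.sum_eq_zero fun b _ ↦ ?_
    by_cases hb : b = a
    · subst hb
      have := he.omegaS_self hx (he.l_mem x hx) b
      unfold omegaS at this
      rw [this, mul_zero]
    · have := hd b hb
      rw [he.secondForm_symm hV hx] at this
      unfold secondForm at this
      rw [this, zero_mul]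
  unfold curv curvature
  simp only [map_sub, sub_apply]
  rw [h3]
  simp only [neg_apply, smul_eq_mul] at h2
  have hself : g.val x (leviCivita g e.l x (e.s a x)) (e.s a x) = secondForm g e a a x := rfl
  rw [hself] at h2
  rw [h4] at h1
  linear_combination -h1 + h2

end Derivatives

end IsAdapted

/-- `λ_a` times the form `d ln λ_a - ω₁¹`. -/
def lnForm (g : LorentzMetric M) (e : Frame M) (a : Fin 2) (x : M) (v : TangentSpace (𝓡 4) x) : ℝ :=
  mvfderiv (𝓡 4) (secondForm g e a a) x v - secondForm g e a a x * omegaL g e x v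

lemma lnForm_add (a : Fin 2) (v w : TangentSpace (𝓡 4) x) :
    lnForm g e a x (v + w) = lnForm g e a x v + lnForm g e a x w := by
  simp only [lnForm, omegaL, map_add, add_apply]; ring

lemma lnForm_smul (a : Fin 2) (c : ℝ) (v : TangentSpace (𝓡 4) x) :
    lnForm g e a x (c • v) = c * lnForm g e a x v := by
  simp only [lnForm, omegaL, map_smul, smul_apply, smul_eq_mul]; ring

/-- This is where `K_a` comes from: dividing the Riccati equation by `λ_a` shows that `-K_a` is the
coefficient of `ω¹` in `d ln λ_a - ω₁¹`. -/
lemma lnForm_l (hV : IsSubmanifold 1 V) (he : IsAdapted g V U e) (hx : x ∈ U ∩ V)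
    (a : Fin 2) (hd : ∀ b, b ≠ a → secondForm g e a b x = 0) (h0 : secondForm g e a a x ≠ 0) :
    lnForm g e a x (e.l x) = -(secondForm g e a a x * coeffK g e a x) := by
  rw [lnForm, he.mvfderiv_secondForm_l hV hx a hd, coeffK]
  field_simp
  ring

/-- In `μ_aab` the sums over `d` drop out, since `λ_ad` vanishes for `d ≠ a` and `ω_a^a` vanishes.
Hence `-K_ab` is the coefficient of `ω^b` in `d ln λ_a - ω₁¹`. -/
lemma lnForm_s (he : IsAdapted g V U e) (hx : x ∈ U ∩ V) (hV : IsSubmanifold 1 V)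
    (a b : Fin 2) (hd : ∀ b, b ≠ a → secondForm g e a b x = 0) (h0 : secondForm g e a a x ≠ 0) :
    lnForm g e a x (e.s b x) = -(secondForm g e a a x * coeffKS g e a b x) := by
  have h1 : ∑ d, secondForm g e a d x * omegaS g e a d x (e.s b x) = 0 :=
    Finset.sum_eq_zero fun d _ ↦ by
      by_cases h : d = a
      · rw [h, he.omegaS_self hx (he.s_mem x hx b), mul_zero]
      · rw [hd d h, zero_mul]
  have h2 : ∑ d, secondForm g e d a x * omegaS g e a d x (e.s b x) = 0 := by
    rw [← h1]
    exact Finset.sum_congr rfl fun d _ ↦ by rw [he.secondForm_symm hV hx]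
  rw [coeffKS, mul_neg, neg_neg, mul_div_cancel₀ _ h0, lnForm, mu, h1, h2]
  ring

end

/-! ### Existence of adapted frames -/

section

variable {g : LorentzMetric M} {X Y Z : VField M} {U V W : Set M} {e : Frame M} {f : M → ℝ} {x : M}

lemma SmoothF.sqrt (hf : SmoothF f U) (h0 : ∀ y ∈ U, 0 < f y) : SmoothF (fun y ↦ √(f y)) U :=
  fun y hy ↦ ((Real.contDiffAt_sqrt (n := ∞) (h0 y hy).ne').contMDiffAt).comp_contMDiffWithinAt y
    (hf y hy)

/-- Quantities known to be nonzero only at points of `V` remain nonzero on an open neighbourhood, to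
which the frames are then restricted. -/
lemma SmoothF.isOpen_ne (hf : SmoothF f U) (hU : IsOpen U) : IsOpen {y ∈ U | f y ≠ 0} :=
  hf.continuousOn.isOpen_inter_preimage hU isOpen_compl_singleton

lemma SmoothF.isOpen_pos (hf : SmoothF f U) (hU : IsOpen U) : IsOpen {y ∈ U | 0 < f y} :=
  hf.continuousOn.isOpen_inter_preimage hU isOpen_Ioi

/-- In Minkowski space a vector orthogonal to an isotropic vector `l` is spacelike or a multiple
of `l`. -/
lemma minkowski_spacelike_of_orthogonal {l u : Fin 4 → ℝ} (h0 : l ≠ 0)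
    (hl : l 0 * l 0 + l 1 * l 1 + l 2 * l 2 - l 3 * l 3 = 0)
    (hu : l 0 * u 0 + l 1 * u 1 + l 2 * u 2 - l 3 * u 3 = 0) :
    (∃ t : ℝ, u = t • l) ∨ 0 < u 0 * u 0 + u 1 * u 1 + u 2 * u 2 - u 3 * u 3 := by
  have hzero : ∀ a b c : ℝ, a ^ 2 + b ^ 2 + c ^ 2 = 0 → a = 0 ∧ b = 0 ∧ c = 0 := by
    intro a b c h
    have ha := sq_nonneg a
    have hb := sq_nonneg b
    have hc := sq_nonneg c
    exact ⟨pow_eq_zero_iff two_ne_zero |>.1 (by linarith),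
      pow_eq_zero_iff two_ne_zero |>.1 (by linarith), pow_eq_zero_iff two_ne_zero |>.1 (by linarith)⟩
  have hl3 : l 3 ≠ 0 := by
    intro h
    apply h0
    rw [h] at hl
    obtain ⟨e0, e1, e2⟩ := hzero (l 0) (l 1) (l 2) (by linear_combination hl)
    ext i
    fin_cases i <;> simp [e0, e1, e2, h]
  obtain ⟨t, h3⟩ : ∃ t, u 3 = t * l 3 := ⟨u 3 / l 3, by field_simp⟩
  have hsq : u 0 * u 0 + u 1 * u 1 + u 2 * u 2 - u 3 * u 3 =
      (u 0 - t * l 0) ^ 2 + (u 1 - t * l 1) ^ 2 + (u 2 - t * l 2) ^ 2 := by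
    rw [h3] at hu ⊢
    linear_combination 2 * t * hu - t ^ 2 * hl
  rw [hsq]
  rcases (show 0 ≤ (u 0 - t * l 0) ^ 2 + (u 1 - t * l 1) ^ 2 + (u 2 - t * l 2) ^ 2 by
    positivity).eq_or_lt with h | h
  · left
    obtain ⟨e0, e1, e2⟩ := hzero _ _ _ h.symm
    refine ⟨t, funext fun i ↦ ?_⟩
    rw [Pi.smul_apply, smul_eq_mul]
    fin_cases i
    · exact sub_eq_zero.1 e0
    · exact sub_eq_zero.1 e1
    · exact sub_eq_zero.1 e2
    · exact h3
  · exact Or.inr h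

/-- A vector orthogonal to an isotropic vector `l` is spacelike or a multiple of `l`. -/
lemma LorentzMetric.spacelike_of_orthogonal (g : LorentzMetric M) {l u : TangentSpace (𝓡 4) x}
    (h0 : l ≠ 0) (hl : g.val x l l = 0) (hu : g.val x l u = 0) :
    (∃ t : ℝ, u = t • l) ∨ 0 < g.val x u u := by
  obtain ⟨b, hb⟩ := g.signature x
  have hval : ∀ v w, g.val x v w = b.repr v 0 * b.repr w 0 + b.repr v 1 * b.repr w 1
      + b.repr v 2 * b.repr w 2 - b.repr v 3 * b.repr w 3 := by
    intro v w
    conv_lhs => rw [← b.sum_repr v, ← b.sum_repr w]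
    simp only [map_sum, map_smul, sum_apply, smul_apply, hb, smul_eq_mul]
    simp only [Fin.sum_univ_four]
    simp
    ring
  rw [hval] at hl hu
  rw [hval]
  refine (minkowski_spacelike_of_orthogonal (l := b.repr l) (u := b.repr u) (fun h ↦ h0 ?_) hl
    hu).imp_left ?_
  · exact b.repr.injective (Finsupp.ext fun i ↦ by rw [h]; simp)
  · rintro ⟨t, ht⟩
    exact ⟨t, b.repr.injective (Finsupp.ext fun i ↦ by rw [ht, map_smul]; rfl)⟩

/-- Three vectors have a common nonzero orthogonal vector. -/
lemma LorentzMetric.exists_orthogonal (g : LorentzMetric M) (x : M)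
    (w : Fin 3 → TangentSpace (𝓡 4) x) : ∃ u, u ≠ 0 ∧ ∀ i, g.val x u (w i) = 0 := by
  have hfin : FiniteDimensional ℝ (TangentSpace (𝓡 4) x) :=
    inferInstanceAs (FiniteDimensional ℝ R4)
  let A : TangentSpace (𝓡 4) x →ₗ[ℝ] (Fin 3 → ℝ) :=
    LinearMap.pi fun i ↦ (g.val x (w i) : TangentSpace (𝓡 4) x →ₗ[ℝ] ℝ)
  have h : LinearMap.ker A ≠ ⊥ := LinearMap.ker_ne_bot_of_finrank_lt (by
    have : Module.finrank ℝ (TangentSpace (𝓡 4) x) = 4 :=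
      finrank_euclideanSpace_fin (𝕜 := ℝ) (n := 4)
    rw [this, Module.finrank_fin_fun]
    norm_num)
  obtain ⟨u, hu, hu0⟩ := Submodule.exists_mem_ne_zero_of_ne_bot h
  refine ⟨u, hu0, fun i ↦ ?_⟩
  rw [g.symm]
  exact congrFun hu i

/-- Near each point of a lightlike hypersurface there is a smooth vector field that is isotropic
along the hypersurface, and orthogonal there precisely to the tangent vectors. -/
lemma IsLightlikeHypersurface.exists_isotropic (hV : IsLightlikeHypersurface g V) (hx : x ∈ V) :
    ∃ (U : Set M) (l : VField M), IsOpen U ∧ x ∈ U ∧ SmoothV l U ∧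
      ∀ y ∈ U ∩ V, l y ≠ 0 ∧ g.val y (l y) (l y) = 0 ∧
        ∀ v, v ∈ tangentSpaceOf V y ↔ g.val y (l y) v = 0 := by
  obtain ⟨U, F, hU, hxU, hF, -, hT⟩ := hV.submanifold.exists_equation hx
  -- The gradient of a defining function is orthogonal to exactly the tangent vectors. A nonzero
  -- vector of the radical is also orthogonal to all of them, hence a multiple of the gradient, so
  -- the gradient is itself tangent and therefore isotropic.
  let l : VField M := fun y ↦ (g.flat y).symm (mvfderiv (𝓡 4) F y)
  have hl : ∀ y (w : TangentSpace (𝓡 4) y), g.val y (l y) w = mvfderiv (𝓡 4) F y w := fun y w ↦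
    g.val_flat_symm y _ w
  refine ⟨U, l, hU, hxU, SmoothV.of_val (g := g) hU fun U' Z hU' hsub hZ ↦ ?_, fun y hy ↦ ?_⟩
  · simp only [hl]
    exact SmoothF.mvfderiv (hF.mono hsub) hZ hU'
  · obtain ⟨⟨v₀, hv₀⟩, hTy⟩ := hT y hy
    obtain ⟨r, hr, hr0⟩ := Submodule.exists_mem_ne_zero_of_ne_bot (hV.degenerate y hy.2)
    have hl0 : l y ≠ 0 := by
      intro h
      apply hv₀
      rw [← hl, h, map_zero, zero_apply]
    set c := g.val y r v₀ / mvfderiv (𝓡 4) F y v₀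
    have hrl : r = c • l y := by
      refine g.ext_val fun w ↦ ?_
      have hw : w - (mvfderiv (𝓡 4) F y w / mvfderiv (𝓡 4) F y v₀) • v₀ ∈ tangentSpaceOf V y := by
        rw [hTy, map_sub, map_smul, smul_eq_mul, div_mul_cancel₀ _ hv₀, sub_self]
      have := hr.2 _ hw
      rw [map_sub, map_smul, smul_eq_mul] at this
      rw [map_smul, smul_apply, hl, smul_eq_mul]
      simp only [c]
      field_simp at this ⊢
      linarith
    have hc : c ≠ 0 := by
      intro h
      exact hr0 (by rw [hrl, h, zero_smul])
    have hlT : l y ∈ tangentSpaceOf V y := by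
      have := hr.1
      rw [hrl] at this
      exact (Submodule.smul_mem_iff _ hc).1 this
    refine ⟨hl0, ?_, fun v ↦ by rw [hTy, hl]⟩
    rw [hl]
    exact (hTy _).1 hlT

/-- Normalization of a vector field to length one. -/
lemma SmoothV.exists_normalize (hU : IsOpen U) (hx : x ∈ U) (hX : SmoothV X U)
    (h0 : 0 < g.val x (X x) (X x)) :
    ∃ (U' : Set M) (f : M → ℝ), IsOpen U' ∧ U' ⊆ U ∧ x ∈ U' ∧ SmoothF f U' ∧
      (∀ y ∈ U', f y ≠ 0) ∧ ∀ y ∈ U', g.val y (f y • X y) (f y • X y) = 1 := by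
  have hs := SmoothF.val (g := g) hX hX
  have hsub : {y ∈ U | 0 < g.val y (X y) (X y)} ⊆ U := fun y hy ↦ hy.1
  have hpos : ∀ y ∈ {y ∈ U | 0 < g.val y (X y) (X y)}, 0 < √(g.val y (X y) (X y)) := fun y hy ↦
    Real.sqrt_pos.2 hy.2
  refine ⟨_, fun y ↦ (√(g.val y (X y) (X y)))⁻¹, SmoothF.isOpen_pos hs hU, hsub, ⟨hx, h0⟩,
    SmoothF.inv (SmoothF.sqrt (hs.mono hsub) fun y hy ↦ hy.2) fun y hy ↦ (hpos y hy).ne',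
    fun y hy ↦ inv_ne_zero (hpos y hy).ne', fun y hy ↦ ?_⟩
  simp only [map_smul, smul_apply, smul_eq_mul]
  have h1 := (hpos y hy).ne'
  have h2 := Real.mul_self_sqrt hy.2.le
  field_simp
  rw [pow_two, h2]

/-- Each point of a lightlike hypersurface has a neighbourhood with an adapted frame. -/
lemma IsLightlikeHypersurface.exists_isAdapted (hV : IsLightlikeHypersurface g V) (hx : x ∈ V) :
    ∃ (U : Set M) (e : Frame M), x ∈ U ∧ IsAdapted g V U e := by
  obtain ⟨U₁, l, hU₁, hxU₁, hl, hlV⟩ := hV.exists_isotropic hx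
  obtain ⟨v₀, hv₀⟩ : ∃ v, g.val x (l x) v ≠ 0 := by
    by_contra! h
    exact (hlV x ⟨hxU₁, hx⟩).1 (g.nondeg x _ h)
  obtain ⟨U₂, N, hU₂, hxU₂, hN, hNx⟩ := exists_smoothV x v₀
  have hO := hU₁.inter hU₂
  have hln := SmoothF.val (g := g) (hl.mono inter_subset_left) (hN.mono (inter_subset_right (s := U₁)))
  -- the field of transversals
  set U₃ := {y ∈ U₁ ∩ U₂ | g.val y (l y) (N y) ≠ 0}
  have hU₃ : IsOpen U₃ := SmoothF.isOpen_ne hln hO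
  have hxU₃ : x ∈ U₃ := ⟨⟨hxU₁, hxU₂⟩, by rw [hNx]; exact hv₀⟩
  have hsub₃ : U₃ ⊆ U₁ ∩ U₂ := fun y hy ↦ hy.1
  replace hl : SmoothV l U₃ := hl.mono fun y hy ↦ hy.1.1
  replace hN : SmoothV N U₃ := hN.mono fun y hy ↦ hy.1.2
  let c : M → ℝ := fun y ↦ -(g.val y (l y) (N y))⁻¹
  have hc : SmoothF c U₃ := (SmoothF.inv (hln.mono hsub₃) fun y hy ↦ hy.2).neg
  let N' : VField M := fun y ↦ c y • N y
  have hN' : SmoothV N' U₃ := SmoothV.smul hc hN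
  have hlN' : ∀ y ∈ U₃, g.val y (l y) (N' y) = -1 := by
    intro y hy
    simp only [N', c, map_smul, smul_eq_mul]
    have := hy.2
    field_simp
  -- With `g(l, N') = -1`, adding `d l` changes the square of `N'` by `-2d` wherever `l` is
  -- isotropic, that is, along `V`.
  let d : M → ℝ := fun y ↦ 1 / 2 * g.val y (N' y) (N' y)
  have hd : SmoothF d U₃ := contMDiffOn_const.mul (SmoothF.val hN' hN')
  let n : VField M := fun y ↦ N' y + d y • l y
  have hn : SmoothV n U₃ := SmoothV.add hN' (SmoothV.smul hd hl)
  have hll : ∀ y ∈ U₃ ∩ V, g.val y (l y) (l y) = 0 := fun y hy ↦ (hlV y ⟨hy.1.1.1, hy.2⟩).2.1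
  have hlnV : ∀ y ∈ U₃ ∩ V, g.val y (l y) (n y) = -1 := by
    intro y hy
    simp only [n, map_add, map_smul, smul_eq_mul, hll y hy, hlN' y hy.1]
    ring
  have hnnV : ∀ y ∈ U₃ ∩ V, g.val y (n y) (n y) = 0 := by
    intro y hy
    have h1 := hlN' y hy.1
    have h2 := h1
    rw [g.symm] at h2
    simp only [n, map_add, map_smul, add_apply, smul_apply, smul_eq_mul, hll y hy, h1, h2, d]
    ring
  -- orthonormal vectors at the given point
  obtain ⟨u₀, hu₀, hu₀'⟩ := g.exists_orthogonal x ![l x, n x, n x]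
  -- For `u₀` only two conditions were needed, and the repeated `n x` filled the third slot.
  obtain ⟨u₁, hu₁, hu₁'⟩ := g.exists_orthogonal x ![l x, n x, u₀]
  have hposi : ∀ u, u ≠ 0 → g.val x u (l x) = 0 → g.val x u (n x) = 0 → 0 < g.val x u u := by
    intro u hu hul hun
    refine (g.spacelike_of_orthogonal (hlV x ⟨hxU₁, hx⟩).1 (hll x ⟨hxU₃, hx⟩)
      (by rw [g.symm]; exact hul)).resolve_left ?_
    rintro ⟨t, rfl⟩
    rw [map_smul, smul_apply, hlnV x ⟨hxU₃, hx⟩, smul_eq_mul] at hun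
    apply hu
    rw [show t = 0 by linarith, zero_smul]
  have hu₀l : g.val x u₀ (l x) = 0 := hu₀' 0
  have hu₀n : g.val x u₀ (n x) = 0 := hu₀' 1
  have hu₁l : g.val x u₁ (l x) = 0 := hu₁' 0
  have hu₁n : g.val x u₁ (n x) = 0 := hu₁' 1
  have hu₁u₀ : g.val x u₁ u₀ = 0 := hu₁' 2
  -- projections to the orthogonal complement of `l` and `n`
  have hproj : ∀ u, g.val x u (l x) = 0 → g.val x u (n x) = 0 → ∃ (O : Set M) (P : VField M),
      IsOpen O ∧ x ∈ O ∧ O ⊆ U₃ ∧ SmoothV P O ∧ P x = u ∧ ∀ y ∈ O ∩ V,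
        g.val y (P y) (l y) = 0 ∧ g.val y (P y) (n y) = 0 := by
    intro u hul hun
    obtain ⟨O, S, hO, hxO, hS, rfl⟩ := exists_smoothV x u
    have hl' : SmoothV l (O ∩ U₃) := hl.mono inter_subset_right
    have hn' : SmoothV n (O ∩ U₃) := hn.mono inter_subset_right
    replace hS : SmoothV S (O ∩ U₃) := hS.mono inter_subset_left
    -- The corrections are added rather than subtracted because `g(l, n) = -1`.
    refine ⟨O ∩ U₃, fun y ↦ (S y + g.val y (S y) (n y) • l y) + g.val y (S y) (l y) • n y,
      hO.inter hU₃, ⟨hxO, hxU₃⟩, inter_subset_right, ?_, ?_, ?_⟩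
    · exact SmoothV.add (SmoothV.add hS (SmoothV.smul (SmoothF.val hS hn') hl'))
        (SmoothV.smul (SmoothF.val hS hl') hn')
    · simp only [hul, hun, zero_smul, add_zero]
    · intro y hy
      have hyV : y ∈ U₃ ∩ V := ⟨hy.1.2, hy.2⟩
      have h2 := hlnV y hyV
      rw [g.symm] at h2
      simp only [map_add, map_smul, add_apply, smul_apply, smul_eq_mul, hll y hyV, hlnV y hyV, h2,
        hnnV y hyV]
      constructor <;> ring
  obtain ⟨O₀, P₀, hO₀, hxO₀, hO₀U, hP₀, hP₀x, hP₀V⟩ := hproj u₀ hu₀l hu₀n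
  obtain ⟨O₁, P₁, hO₁, hxO₁, hO₁U, hP₁, hP₁x, hP₁V⟩ := hproj u₁ hu₁l hu₁n
  obtain ⟨O₂, c₀, hO₂, hO₂₀, hxO₂, hc₀, hc₀', hs₀⟩ := SmoothV.exists_normalize (g := g) hO₀ hxO₀ hP₀
    (by rw [hP₀x]; exact hposi u₀ hu₀ hu₀l hu₀n)
  let s₀ : VField M := fun y ↦ c₀ y • P₀ y
  have hs₀s : SmoothV s₀ O₂ := SmoothV.smul hc₀ (hP₀.mono hO₂₀)
  have hs₀V : ∀ y ∈ O₂ ∩ V, g.val y (s₀ y) (l y) = 0 ∧ g.val y (s₀ y) (n y) = 0 := by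
    intro y hy
    have := hP₀V y ⟨hO₂₀ hy.1, hy.2⟩
    simp [s₀, this]
  -- A Gram–Schmidt step; the correction vanishes at `x`, where `u₁` is already orthogonal to `u₀`,
  -- so `Q` stays spacelike there.
  let Q : VField M := fun y ↦ P₁ y + (-g.val y (P₁ y) (s₀ y)) • s₀ y
  have hQ : SmoothV Q (O₂ ∩ O₁) := SmoothV.add (hP₁.mono inter_subset_right)
    (SmoothV.smul (SmoothF.val (hP₁.mono inter_subset_right) (hs₀s.mono inter_subset_left)).neg
      (hs₀s.mono inter_subset_left))
  have hQx : Q x = u₁ := by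
    simp only [Q, s₀, hP₀x, hP₁x, map_smul, hu₁u₀, smul_zero, neg_zero, zero_smul, add_zero]
  obtain ⟨O₃, c₁, hO₃, hO₃₂, hxO₃, hc₁, -, hs₁⟩ := SmoothV.exists_normalize (g := g)
    (hO₂.inter hO₁) ⟨hxO₂, hxO₁⟩ hQ (by rw [hQx]; exact hposi u₁ hu₁ hu₁l hu₁n)
  let s₁ : VField M := fun y ↦ c₁ y • Q y
  have hQV : ∀ y ∈ O₃ ∩ V, g.val y (Q y) (l y) = 0 ∧ g.val y (Q y) (n y) = 0 ∧
      g.val y (Q y) (s₀ y) = 0 := by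
    intro y hy
    have h1 := hs₀V y ⟨(hO₃₂ hy.1).1, hy.2⟩
    have h2 := hP₁V y ⟨(hO₃₂ hy.1).2, hy.2⟩
    have h3 : g.val y (s₀ y) (s₀ y) = 1 := hs₀ y (hO₃₂ hy.1).1
    simp [Q, h1, h2, h3]
  have hs₁V : ∀ y ∈ O₃ ∩ V, g.val y (s₁ y) (l y) = 0 ∧ g.val y (s₁ y) (n y) = 0 ∧
      g.val y (s₁ y) (s₀ y) = 0 := by
    intro y hy
    simp [s₁, hQV y hy]
  have hO₃U : O₃ ⊆ U₃ := fun y hy ↦ hO₁U (hO₃₂ hy).2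
  have hsl : ∀ y ∈ O₃ ∩ V, ∀ a, g.val y ((![s₀, s₁] : Fin 2 → VField M) a y) (l y) = 0 := by
    intro y hy a
    fin_cases a
    · exact (hs₀V y ⟨(hO₃₂ hy.1).1, hy.2⟩).1
    · exact (hs₁V y hy).1
  refine ⟨O₃, ⟨l, ![s₀, s₁], n⟩, hxO₃, ⟨hO₃, hl.mono hO₃U, fun a ↦ ?_, hn.mono hO₃U, fun y hy ↦ ?_,
    fun y hy a ↦ ?_, fun y hy ↦ hll y ⟨hO₃U hy.1, hy.2⟩, fun y hy a ↦ ?_,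
    fun y hy ↦ hlnV y ⟨hO₃U hy.1, hy.2⟩, fun y hy a b ↦ ?_, fun y hy a ↦ ?_,
    fun y hy ↦ hnnV y ⟨hO₃U hy.1, hy.2⟩⟩⟩
  · fin_cases a
    · exact hs₀s.mono fun y hy ↦ (hO₃₂ hy).1
    · exact SmoothV.smul hc₁ (hQ.mono hO₃₂)
  · exact ((hlV y ⟨(hO₃U hy.1).1.1, hy.2⟩).2.2 _).2 (hll y ⟨hO₃U hy.1, hy.2⟩)
  · exact ((hlV y ⟨(hO₃U hy.1).1.1, hy.2⟩).2.2 _).2 (by rw [g.symm]; exact hsl y hy a)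
  · rw [g.symm]; exact hsl y hy a
  · have h01 := (hs₁V y hy).2.2
    fin_cases a <;> fin_cases b
    · exact hs₀ y (hO₃₂ hy.1).1
    · rw [g.symm]; exact h01
    · exact h01
    · exact hs₁ y hy.1
  · fin_cases a
    · exact (hs₀V y ⟨(hO₃₂ hy.1).1, hy.2⟩).2
    · exact (hs₁V y hy).2.1

end

/-! ### Existence of eigenframes -/

section

variable {g : LorentzMetric M} {U V W : Set M} {e : Frame M} {x : M}
  {lam : Fin 2 → (x : M) → TangentSpace (𝓡 4) x → ℝ}

/-- The frame obtained by applying the matrices `r` to the screen vectors. -/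
def Frame.rotate (e : Frame M) (r : Fin 2 → Fin 2 → M → ℝ) : Frame M where
  l := e.l
  s a := fun y ↦ r a 0 y • e.s 0 y + r a 1 y • e.s 1 y
  n := e.n

lemma IsAdapted.rotate (he : IsAdapted g V U e) {r : Fin 2 → Fin 2 → M → ℝ}
    (hr : ∀ a b, SmoothF (r a b) U)
    (horth : ∀ y ∈ U, ∀ a b, r a 0 y * r b 0 y + r a 1 y * r b 1 y = if a = b then 1 else 0) :
    IsAdapted g V U (e.rotate r) where
  isOpen := he.isOpen
  smooth_l := he.smooth_l
  smooth_s a := SmoothV.add (SmoothV.smul (hr a 0) (he.smooth_s 0))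
    (SmoothV.smul (hr a 1) (he.smooth_s 1))
  smooth_n := he.smooth_n
  l_mem := he.l_mem
  s_mem y hy a := add_mem (Submodule.smul_mem _ _ (he.s_mem y hy 0))
    (Submodule.smul_mem _ _ (he.s_mem y hy 1))
  l_l := he.l_l
  l_s y hy a := by simp [Frame.rotate, he.l_s y hy]
  l_n := he.l_n
  s_s y hy a b := by
    rw [← horth y hy.1 a b]
    simp [Frame.rotate, he.s_s y hy]
  s_n y hy a := by simp [Frame.rotate, he.s_n y hy]
  n_n := he.n_n

lemma secondForm_rotate (r : Fin 2 → Fin 2 → M → ℝ) (a b : Fin 2) (y : M) :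
    secondForm g (e.rotate r) a b y = r a 0 y * r b 0 y * secondForm g e 0 0 y
      + r a 0 y * r b 1 y * secondForm g e 0 1 y + r a 1 y * r b 0 y * secondForm g e 1 0 y
      + r a 1 y * r b 1 y * secondForm g e 1 1 y := by
  simp only [secondForm, Frame.rotate, map_add, map_smul, add_apply, smul_apply, smul_eq_mul]
  ring

lemma IsAdapted.trace_det (hlam : IsEigenvaluePair g V lam) (he : IsAdapted g V U e)
    (hx : x ∈ U ∩ V) :
    secondForm g e 0 0 x + secondForm g e 1 1 x = lam 0 x (e.l x) + lam 1 x (e.l x) ∧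
    secondForm g e 0 0 x * secondForm g e 1 1 x - secondForm g e 0 1 x * secondForm g e 1 0 x
      = lam 0 x (e.l x) * lam 1 x (e.l x) := by
  have h := hlam.charpoly U e he x hx
  rw [Matrix.charpoly_fin_two, Fin.prod_univ_two, Matrix.trace_fin_two, Matrix.det_fin_two] at h
  -- The value of the quadratic characteristic polynomial at `0` is the determinant; the value at
  -- `1` then yields the trace.
  have h0 := congrArg (Polynomial.eval 0) h
  have h1 := congrArg (Polynomial.eval 1) h
  simp at h0 h1
  rw [h0] at h1
  exact ⟨by linarith, h0⟩

/-- An adapted frame in which the second fundamental tensor is diagonal. -/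
lemma IsAdapted.exists_diagonal (hV : IsSubmanifold 1 V) (he : IsAdapted g V U e)
    (hx : x ∈ U) (hne : secondForm g e 0 0 x ≠ secondForm g e 1 1 x) :
    ∃ U' e', x ∈ U' ∧ IsAdapted g V U' e' ∧
      ∀ y ∈ U' ∩ V, secondForm g e' 0 1 y = 0 ∧ secondForm g e' 1 0 y = 0 := by
  have hs := fun a b ↦ he.smoothF_secondForm a b
  have hD : SmoothF (fun y ↦ secondForm g e 0 0 y - secondForm g e 1 1 y) U := (hs 0 0).sub (hs 1 1)
  have hU' := SmoothF.isOpen_ne hD he.isOpen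
  set U' := {y ∈ U | secondForm g e 0 0 y - secondForm g e 1 1 y ≠ 0}
  have hsub : U' ⊆ U := fun y hy ↦ hy.1
  have he' := he.mono hU' hsub
  -- The diagonalizing angle `θ` satisfies `tan 2θ = 2h`.
  let h : M → ℝ := fun y ↦ secondForm g e 0 1 y / (secondForm g e 0 0 y - secondForm g e 1 1 y)
  have hh : SmoothF h U' := SmoothF.div ((hs 0 1).mono hsub) (hD.mono hsub) fun y hy ↦ hy.2
  let q : M → ℝ := fun y ↦ √(1 + 4 * (h y * h y))
  have hq : SmoothF q U' := SmoothF.sqrt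
    (contMDiffOn_const.add (contMDiffOn_const.mul (hh.mul hh))) fun y _ ↦ by
      nlinarith [mul_self_nonneg (h y)]
  have hq0 : ∀ y, 0 < 1 + q y := fun y ↦ by
    have : 0 ≤ q y := Real.sqrt_nonneg _
    linarith
  have hqq : ∀ y, q y * q y = 1 + 4 * (h y * h y) := fun y ↦
    Real.mul_self_sqrt (by nlinarith [mul_self_nonneg (h y)])
  -- This is `tan θ`, the root of `h t² + t - h = 0` that vanishes with `h`. Rationalizing the
  -- quadratic formula avoids division by `h` and makes it smooth at `h = 0`. Below, `c` is `cos θ`.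
  let t : M → ℝ := fun y ↦ 2 * h y / (1 + q y)
  have ht : SmoothF t U' := SmoothF.div (contMDiffOn_const.mul hh) (contMDiffOn_const.add hq)
    fun y _ ↦ (hq0 y).ne'
  have htq : ∀ y, t y * (1 + q y) = 2 * h y := fun y ↦ div_mul_cancel₀ _ (hq0 y).ne'
  have heq : ∀ y, (1 - t y * t y) * h y = t y := by
    intro y
    have h1 := hq0 y
    have h2 := hqq y
    have h3 : t y = 2 * h y / (1 + q y) := rfl
    rw [h3]
    field_simp
    linear_combination h y * h2
  let r : M → ℝ := fun y ↦ √(1 + t y * t y)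
  have hr : SmoothF r U' := SmoothF.sqrt
    (contMDiffOn_const.add (ht.mul ht)) fun y _ ↦ by nlinarith [mul_self_nonneg (t y)]
  have hr0 : ∀ y, 0 < r y := fun y ↦ Real.sqrt_pos.2 (by nlinarith [mul_self_nonneg (t y)])
  have hrr : ∀ y, r y * r y = 1 + t y * t y := fun y ↦
    Real.mul_self_sqrt (by nlinarith [mul_self_nonneg (t y)])
  let c : M → ℝ := fun y ↦ (r y)⁻¹
  have hc : SmoothF c U' := SmoothF.inv hr fun y _ ↦ (hr0 y).ne'
  have hcc : ∀ y, c y * c y * (1 + t y * t y) = 1 := by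
    intro y
    rw [← hrr]
    have := (hr0 y).ne'
    simp only [c]
    field_simp
  let R : Fin 2 → Fin 2 → M → ℝ := fun a b y ↦
    (!![c y, t y * c y; -(t y * c y), c y] : Matrix (Fin 2) (Fin 2) ℝ) a b
  have hRs : ∀ a b, SmoothF (R a b) U' := by
    intro a b
    fin_cases a <;> fin_cases b
    · exact hc
    · exact ht.mul hc
    · exact (ht.mul hc).neg
    · exact hc
  have hRo : ∀ y ∈ U', ∀ a b, R a 0 y * R b 0 y + R a 1 y * R b 1 y = if a = b then 1 else 0 := by
    intro y _ a b
    fin_cases a <;> fin_cases b <;> simp [R]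
    · linear_combination hcc y
    · ring
    · ring
    · linear_combination hcc y
  have hfin := he'.rotate hRs hRo
  have h01 : ∀ y ∈ U' ∩ V, secondForm g (e.rotate R) 0 1 y = 0 := by
    intro y hy
    have hsym := he'.secondForm_symm hV hy 1 0
    have hq1 : secondForm g e 0 1 y = h y * (secondForm g e 0 0 y - secondForm g e 1 1 y) :=
      (div_mul_cancel₀ _ hy.1.2).symm
    rw [secondForm_rotate, hsym, hq1]
    simp [R]
    linear_combination (c y * c y) * (secondForm g e 0 0 y - secondForm g e 1 1 y) * heq y
  exact ⟨U', e.rotate R, ⟨hx, sub_ne_zero.2 hne⟩, hfin, fun y hy ↦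
    ⟨h01 y hy, by rw [hfin.secondForm_symm hV hy]; exact h01 y hy⟩⟩

/-- Near each point there is an adapted frame in which the second fundamental tensor is diagonal,
with prescribed order of the eigenvalues. -/
lemma IsLightlikeHypersurface.exists_isEigenframe (hV : IsLightlikeHypersurface g V)
    (hlam : IsEigenvaluePair g V lam)
    (hdist : ∀ x ∈ V, ∀ l ∈ radical g V x, l ≠ 0 → lam 0 x l ≠ lam 1 x l) (hx : x ∈ V) :
    ∃ U e, x ∈ U ∧ IsEigenframe g V lam U e := by
  -- an adapted frame with different diagonal entries
  have step1 : ∃ U e, x ∈ U ∧ IsAdapted g V U e ∧ secondForm g e 0 0 x ≠ secondForm g e 1 1 x := by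
    obtain ⟨U, e, hxU, he⟩ := hV.exists_isAdapted hx
    -- With equal diagonal entries, the off-diagonal entry is nonzero since the eigenvalues differ.
    -- Rotating by 45 degrees makes the diagonal entries differ by twice that entry.
    by_cases h : secondForm g e 0 0 x = secondForm g e 1 1 x
    · have hd := hdist x hx _ (he.l_mem_radical hV.submanifold ⟨hxU, hx⟩) (he.l_ne_zero ⟨hxU, hx⟩)
      obtain ⟨h1, h2⟩ := he.trace_det hlam ⟨hxU, hx⟩
      have hsym := he.secondForm_symm hV.submanifold ⟨hxU, hx⟩ 1 0
      have hq : secondForm g e 0 1 x ≠ 0 := by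
        intro h0
        apply hd
        rw [h0, zero_mul, sub_zero, h] at h2
        rw [h] at h1
        have : (lam 0 x (e.l x) - lam 1 x (e.l x)) ^ 2 = 0 := by
          linear_combination (-(lam 0 x (e.l x) + lam 1 x (e.l x)) - 2 * secondForm g e 1 1 x) * h1 + 4 * h2
        exact sub_eq_zero.1 (pow_eq_zero_iff two_ne_zero |>.1 this)
      let c : ℝ := (√2)⁻¹
      have hcc : c * c = 1 / 2 := by
        have := Real.mul_self_sqrt (show (0 : ℝ) ≤ 2 by norm_num)
        simp only [c]
        rw [← mul_inv, this]
        norm_num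
      refine ⟨U, e.rotate fun a b _ ↦ (!![c, c; -c, c] : Matrix (Fin 2) (Fin 2) ℝ) a b, hxU,
        he.rotate (fun _ _ ↦ contMDiffOn_const) ?_, ?_⟩
      · intro y _ a b
        fin_cases a <;> fin_cases b <;> simp <;> linarith
      · rw [secondForm_rotate, secondForm_rotate, hsym, ← h]
        simp
        intro h3
        apply hq
        linear_combination h3 / 2 - 2 * secondForm g e 0 1 x * hcc
    · exact ⟨U, e, hxU, he, h⟩
  obtain ⟨U₀, e₀, hxU₀, he₀, hne⟩ := step1
  obtain ⟨U₁, e₁, hxU₁, he₁, hdiag₁⟩ := he₀.exists_diagonal hV.submanifold hxU₀ hne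
  have hcase : ∀ {U e}, IsAdapted g V U e →
      (∀ y ∈ U ∩ V, secondForm g e 0 1 y = 0 ∧ secondForm g e 1 0 y = 0) → ∀ y ∈ U ∩ V,
      (secondForm g e 0 0 y = lam 0 y (e.l y) ∧ secondForm g e 1 1 y = lam 1 y (e.l y)) ∨
      (secondForm g e 0 0 y = lam 1 y (e.l y) ∧ secondForm g e 1 1 y = lam 0 y (e.l y)) := by
    intro U e he hd y hy
    obtain ⟨h1, h2⟩ := he.trace_det hlam hy
    rw [(hd y hy).1, zero_mul, sub_zero] at h2
    have : (secondForm g e 0 0 y - lam 0 y (e.l y)) * (secondForm g e 0 0 y - lam 1 y (e.l y)) = 0 := by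
      linear_combination secondForm g e 0 0 y * h1 - h2
    rcases mul_eq_zero.1 this with h | h
    · left; constructor <;> linarith
    · right; constructor <;> linarith
  -- the right order at `x`
  have step2 : ∃ U e, x ∈ U ∧ IsAdapted g V U e ∧
      (∀ y ∈ U ∩ V, secondForm g e 0 1 y = 0 ∧ secondForm g e 1 0 y = 0) ∧
      secondForm g e 0 0 x = lam 0 x (e.l x) ∧ secondForm g e 1 1 x = lam 1 x (e.l x) := by
    rcases hcase he₁ hdiag₁ x ⟨hxU₁, hx⟩ with h | h
    · exact ⟨U₁, e₁, hxU₁, he₁, hdiag₁, h⟩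
    · refine ⟨U₁, e₁.rotate fun a b _ ↦ (!![0, 1; 1, 0] : Matrix (Fin 2) (Fin 2) ℝ) a b, hxU₁,
        he₁.rotate (fun _ _ ↦ contMDiffOn_const) ?_, ?_, ?_⟩
      · intro y _ a b
        fin_cases a <;> fin_cases b <;> simp
      · intro y hy
        simp [secondForm_rotate, hdiag₁ y hy]
      · simpa [secondForm_rotate] using ⟨h.2, h.1⟩
  obtain ⟨U, e, hxU, he, hd, h0, h1⟩ := step2
  -- The sign of `E` detects the order of the eigenvalues on the diagonal: `E` is `(λ₂ - λ₃)²` for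
  -- the right order and its negative for the wrong one. By continuity of the eigenvalues the right
  -- order at `x` persists nearby.
  let E : M → ℝ := fun y ↦ (secondForm g e 0 0 y - secondForm g e 1 1 y) *
    (lam 0 y (e.l y) - lam 1 y (e.l y))
  have hE : ContinuousOn E (U ∩ V) :=
    (((he.smoothF_secondForm 0 0).continuousOn.mono inter_subset_left).sub
      ((he.smoothF_secondForm 1 1).continuousOn.mono inter_subset_left)).mul
    ((hlam.continuousOn U e he 0).sub (hlam.continuousOn U e he 1))
  have hdl : ∀ y ∈ U ∩ V, lam 0 y (e.l y) ≠ lam 1 y (e.l y) := fun y hy ↦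
    hdist y hy.2 _ (he.l_mem_radical hV.submanifold hy) (he.l_ne_zero hy)
  have hEx : 0 < E x := by
    simp only [E, h0, h1]
    exact mul_self_pos.2 (sub_ne_zero.2 (hdl x ⟨hxU, hx⟩))
  obtain ⟨O, hO, hOE⟩ := continuousOn_iff'.1 hE (Ioi 0) isOpen_Ioi
  have hxO : x ∈ O := by
    have : x ∈ E ⁻¹' Ioi 0 ∩ (U ∩ V) := ⟨hEx, hxU, hx⟩
    rw [hOE] at this
    exact this.1
  refine ⟨U ∩ O, e, ⟨hxU, hxO⟩, he.mono (he.isOpen.inter hO) inter_subset_left, fun y hy a b ↦ ?_⟩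
  have hyU : y ∈ U ∩ V := ⟨hy.1.1, hy.2⟩
  have hEy : 0 < E y := by
    have : y ∈ O ∩ (U ∩ V) := ⟨hy.1.2, hyU⟩
    rw [← hOE] at this
    exact this.1
  have hgood : secondForm g e 0 0 y = lam 0 y (e.l y) ∧
      secondForm g e 1 1 y = lam 1 y (e.l y) := by
    refine (hcase he hd y hyU).resolve_right fun h ↦ ?_
    simp only [E, h.1, h.2] at hEy
    nlinarith [mul_self_nonneg (lam 0 y (e.l y) - lam 1 y (e.l y))]
  fin_cases a <;> fin_cases b
  · exact hgood.1
  · exact (hd y hyU).1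
  · exact (hd y hyU).2
  · exact hgood.2

end

/-! ### Change of eigenframe -/

section

variable {g : LorentzMetric M} {U V W : Set M} {e : Frame M} {x : M}
  {lam : Fin 2 → (x : M) → TangentSpace (𝓡 4) x → ℝ}

lemma leviCivita_smul {f : M → ℝ} {X : VField M} (hf : MDifferentiableAt (𝓡 4) 𝓘(ℝ) f x)
    (hX : DiffV X x) (v : TangentSpace (𝓡 4) x) :
    leviCivita g (fun y ↦ f y • X y) x v =
      f x • leviCivita g X x v + mvfderiv (𝓡 4) f x v • X x :=
  congrArg (fun A : TangentSpace (𝓡 4) x →L[ℝ] TangentSpace (𝓡 4) x ↦ A v)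
    ((leviCivita g).isCovariantDerivativeOnUniv.leibniz hX hf)

namespace IsEigenframe

lemma mono (he : IsEigenframe g V lam U e) {U' : Set M} (hU' : IsOpen U') (h : U' ⊆ U) :
    IsEigenframe g V lam U' e :=
  ⟨he.toIsAdapted.mono hU' h, fun y hy ↦ he.diagonal y ⟨h hy.1, hy.2⟩⟩

lemma secondForm_self (he : IsEigenframe g V lam U e) (hx : x ∈ U ∩ V) (a : Fin 2) :
    secondForm g e a a x = lam a x (e.l x) := by
  rw [he.diagonal x hx, if_pos rfl]

lemma secondForm_of_ne (he : IsEigenframe g V lam U e) (hx : x ∈ U ∩ V) {a b : Fin 2}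
    (h : a ≠ b) : secondForm g e a b x = 0 := by
  rw [he.diagonal x hx, if_neg h]

lemma secondForm_self_ne_zero (hV : IsSubmanifold 1 V)
    (hne : ∀ a, ∀ x ∈ V, ∀ l ∈ radical g V x, l ≠ 0 → lam a x l ≠ 0)
    (he : IsEigenframe g V lam U e) (hx : x ∈ U ∩ V) (a : Fin 2) :
    secondForm g e a a x ≠ 0 := by
  rw [he.secondForm_self hx]
  exact hne a x hx.2 _ (he.l_mem_radical hV hx) (he.l_ne_zero hx)

lemma val_cov_l_s' (hV : IsSubmanifold 1 V) (he : IsEigenframe g V lam U e) (hx : x ∈ U ∩ V)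
    {v : TangentSpace (𝓡 4) x} (hv : v ∈ tangentSpaceOf V x) (a : Fin 2) :
    g.val x (leviCivita g e.l x v) (e.s a x) = secondForm g e a a x * g.val x v (e.s a x) := by
  rw [he.val_cov_l_s hV hx hv]
  exact Finset.sum_eq_single a (fun b _ hb ↦ by
    rw [he.secondForm_of_ne hx hb.symm, zero_mul]) (by simp)

/-- The change of the quantities `λ_a`, `K_a`, `K_ab` under a change of the eigenframe. -/
lemma exists_change (hV : IsSubmanifold 1 V) (hlam : IsEigenvaluePair g V lam)
    (hne : ∀ a, ∀ x ∈ V, ∀ l ∈ radical g V x, l ≠ 0 → lam a x l ≠ 0)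
    (hdist : ∀ x ∈ V, ∀ l ∈ radical g V x, l ≠ 0 → lam 0 x l ≠ lam 1 x l)
    (he : IsEigenframe g V lam U e) {U' : Set M} {e' : Frame M}
    (he' : IsEigenframe g V lam U' e') (hxU : x ∈ U) (hxU' : x ∈ U') (hxV : x ∈ V) :
    ∃ (c : ℝ) (ε t : Fin 2 → ℝ), c ≠ 0 ∧ (∀ b, ε b * ε b = 1) ∧ e'.l x = c • e.l x ∧
      (∀ b, e'.s b x = ε b • e.s b x + t b • e.l x) ∧
      (∀ a, secondForm g e' a a x = c * secondForm g e a a x) ∧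
      (∀ a, coeffK g e' a x = c * coeffK g e a x) ∧
      (∀ a b, coeffKS g e' a b x =
        ε b * coeffKS g e a b x - t b * (secondForm g e b b x - coeffK g e a x)) := by
  have hO := he.isOpen.inter he'.isOpen
  have hx : x ∈ U ∩ V := ⟨hxU, hxV⟩
  have hx' : x ∈ U' ∩ V := ⟨hxU', hxV⟩
  have hxO : x ∈ U ∩ U' := ⟨hxU, hxU'⟩
  have heO : IsAdapted g V (U ∩ U') e := he.toIsAdapted.mono hO inter_subset_left
  have heO' : IsAdapted g V (U ∩ U') e' := he'.toIsAdapted.mono hO inter_subset_right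
  -- The factor relating the isotropic fields is needed as a smooth function near `x`, not just at
  -- `x`, because `ω₁¹` changes by `d ln k`.
  let k : M → ℝ := fun y ↦ -g.val y (e'.l y) (e.n y)
  have hk : SmoothF k (U ∩ U') := (SmoothF.val heO'.smooth_l heO.smooth_n).neg
  have hlk : ∀ y ∈ (U ∩ U') ∩ V, e'.l y = k y • e.l y := by
    intro y hy
    have h1 := heO.expand_tangent hV hy (heO'.l_mem y hy)
    rwa [Finset.sum_eq_zero fun a _ ↦ by
      rw [(heO'.l_mem_radical hV hy).2 _ (heO.s_mem y hy a), zero_smul], add_zero] at h1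
  have hc0 : k x ≠ 0 := by
    intro h
    apply he'.l_ne_zero hx'
    rw [hlk x ⟨hxO, hxV⟩, h, zero_smul]
  have hcov : ∀ v ∈ tangentSpaceOf V x, leviCivita g e'.l x v =
      k x • leviCivita g e.l x v + mvfderiv (𝓡 4) k x v • e.l x := by
    intro v hv
    rw [leviCivita_congr_of_tangent (g := g) hO heO'.smooth_l (SmoothV.smul hk heO.smooth_l) hlk hxO hxV hv,
      leviCivita_smul (SmoothF.mdiff hk hO hxO) (SmoothV.diffV heO.smooth_l hO hxO)]
  have hsf' : ∀ a, ∀ y ∈ (U ∩ U') ∩ V, secondForm g e' a a y = k y * secondForm g e a a y := by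
    intro a y hy
    rw [he'.secondForm_self ⟨hy.1.2, hy.2⟩, he.secondForm_self ⟨hy.1.1, hy.2⟩, hlk y hy,
      hlam.smul a y hy.2 _ (heO.l_mem_radical hV hy)]
  -- the matrix of the change of the screen vectors
  let r : Fin 2 → Fin 2 → ℝ := fun b d ↦ g.val x (e'.s b x) (e.s d x)
  let t : Fin 2 → ℝ := fun b ↦ -g.val x (e'.s b x) (e.n x)
  have hs' : ∀ b, e'.s b x = t b • e.l x + ∑ d, r b d • e.s d x := fun b ↦
    he.expand_tangent hV hx (he'.s_mem x hx' b)
  have hls' : ∀ a, g.val x (e.l x) (e'.s a x) = 0 := fun a ↦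
    (he.l_mem_radical hV hx).2 _ (he'.s_mem x hx' a)
  have horth : ∀ a, r a 0 * r a 0 + r a 1 * r a 1 = 1 := by
    intro a
    have h1 := he'.s_s x hx' a a
    rw [if_pos rfl] at h1
    rw [← h1]
    nth_rewrite 2 [hs' a]
    rw [map_add, map_smul, g.symm x _ (e.l x), hls', Fin.sum_univ_two, map_add, map_smul, map_smul]
    simp [r]
  -- The entry `λ_aa'` is computed twice, by the weight of the eigenvalue and by expanding `e_a'`.
  -- As each row of `r` is a unit vector and the eigenvalues are distinct, the off-diagonal entries
  -- of `r` must vanish.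
  have hform : ∀ a, k x * secondForm g e a a x =
      k x * (r a 0 * r a 0 * secondForm g e 0 0 x + r a 1 * r a 1 * secondForm g e 1 1 x) := by
    intro a
    rw [← hsf' a x ⟨hxO, hxV⟩]
    have hT := he'.s_mem x hx' a
    unfold secondForm
    rw [hcov _ hT, map_add, map_smul, map_smul, add_apply, smul_apply, smul_apply, hls']
    nth_rewrite 2 [hs' a]
    rw [map_add, map_smul, he.val_cov_l_l hx hT, Fin.sum_univ_two, map_add, map_smul, map_smul,
      he.val_cov_l_s' hV hx hT, he.val_cov_l_s' hV hx hT]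
    simp only [smul_eq_mul, r, secondForm]
    ring
  have hdl : secondForm g e 0 0 x ≠ secondForm g e 1 1 x := by
    rw [he.secondForm_self hx, he.secondForm_self hx]
    exact hdist x hxV _ (he.l_mem_radical hV hx) (he.l_ne_zero hx)
  have hr01 : r 0 1 = 0 := by
    have h1 := mul_left_cancel₀ hc0 (hform 0)
    have h2 := horth 0
    have h3 : r 0 1 * r 0 1 * (secondForm g e 0 0 x - secondForm g e 1 1 x) = 0 := by
      linear_combination h1 + secondForm g e 0 0 x * h2
    exact mul_self_eq_zero.1 ((mul_eq_zero.1 h3).resolve_right (sub_ne_zero.2 hdl))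
  have hr10 : r 1 0 = 0 := by
    have h1 := mul_left_cancel₀ hc0 (hform 1)
    have h2 := horth 1
    have h3 : r 1 0 * r 1 0 * (secondForm g e 0 0 x - secondForm g e 1 1 x) = 0 := by
      linear_combination -h1 - secondForm g e 1 1 x * h2
    exact mul_self_eq_zero.1 ((mul_eq_zero.1 h3).resolve_right (sub_ne_zero.2 hdl))
  let ε : Fin 2 → ℝ := fun b ↦ r b b
  have hε : ∀ b, ε b * ε b = 1 := by
    intro b
    have := horth b
    fin_cases b
    · simpa [hr01, ε] using this
    · simpa [hr10, ε] using this
  have hs : ∀ b, e'.s b x = ε b • e.s b x + t b • e.l x := by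
    intro b
    rw [hs' b, Fin.sum_univ_two, add_comm]
    fin_cases b
    · simp [hr01, ε]
    · simp [hr10, ε]
  have hln' : k x * g.val x (e.l x) (e'.n x) = -1 := by
    have := he'.l_n x hx'
    rwa [hlk x ⟨hxO, hxV⟩, map_smul, smul_apply, smul_eq_mul] at this
  have hsn' : ∀ b, k x * g.val x (e.s b x) (e'.n x) = ε b * t b := by
    intro b
    have h1 := he'.s_n x hx' b
    rw [hs b, map_add, map_smul, map_smul, add_apply, smul_apply, smul_apply, smul_eq_mul,
      smul_eq_mul] at h1
    linear_combination (ε b * k x) * h1 - ε b * t b * hln' -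
      (k x * g.val x (e.s b x) (e'.n x)) * hε b
  -- The terms with `dk` from `dλ_a'` and from `ω₁¹'` cancel. The remaining sum reflects that `e₄'`
  -- has screen components relative to the old frame, given by `hsn'`; it vanishes on `e₁` and
  -- equals `ε_b t_b λ_b` on `e_b`.
  have hform' : ∀ a, ∀ v ∈ tangentSpaceOf V x, lnForm g e' a x v =
      k x * lnForm g e a x v + k x * secondForm g e a a x *
        ∑ b, ε b * t b * g.val x (leviCivita g e.l x v) (e.s b x) := by
    intro a v hv
    have h1 : mvfderiv (𝓡 4) (secondForm g e' a a) x v =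
        k x * mvfderiv (𝓡 4) (secondForm g e a a) x v
          + secondForm g e a a x * mvfderiv (𝓡 4) k x v := by
      rw [mvfderiv_congr_of_tangent hO (heO'.smoothF_secondForm a a)
        (hk.mul (heO.smoothF_secondForm a a)) (hsf' a) hxO hv]
      have := mvfderiv_mul (SmoothF.mdiff hk hO hxO)
        (SmoothF.mdiff (heO.smoothF_secondForm a a) hO hxO)
      exact congrArg (fun A : TangentSpace (𝓡 4) x →L[ℝ] ℝ ↦ A v) this
    have hcT : leviCivita g e.l x v ∈ tangentSpaceOf V x :=
      (he.mem_tangent_iff hV hx _).2 (he.val_cov_l_l hx hv)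
    have h2 : k x * g.val x (leviCivita g e.l x v) (e'.n x) = -omegaL g e x v +
        ∑ b, ε b * t b * g.val x (leviCivita g e.l x v) (e.s b x) := by
      conv_lhs => rw [he.expand_tangent hV hx hcT]
      simp only [map_add, map_smul, map_sum, add_apply, smul_apply, sum_apply, smul_eq_mul]
      rw [mul_add, Finset.mul_sum]
      congr 1
      · unfold omegaL
        linear_combination (-(g.val x (leviCivita g e.l x v) (e.n x))) * hln'
      · refine Finset.sum_congr rfl fun b _ ↦ ?_
        rw [← hsn' b]
        ring
    unfold lnForm
    rw [h1, hsf' a x ⟨hxO, hxV⟩]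
    have h3 : omegaL g e' x v = -(k x * g.val x (leviCivita g e.l x v) (e'.n x)
        + mvfderiv (𝓡 4) k x v * g.val x (e.l x) (e'.n x)) := by
      unfold omegaL
      rw [hcov v hv, map_add, map_smul, map_smul, add_apply, smul_apply, smul_apply, smul_eq_mul,
        smul_eq_mul]
    rw [h3, h2]
    linear_combination (secondForm g e a a x * mvfderiv (𝓡 4) k x v) * hln'
  have hoff : ∀ a b, b ≠ a → secondForm g e a b x = 0 := fun a b h ↦ he.secondForm_of_ne hx h.symm
  have hoff' : ∀ a b, b ≠ a → secondForm g e' a b x = 0 := fun a b h ↦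
    he'.secondForm_of_ne hx' h.symm
  have hnz := fun a ↦ he.secondForm_self_ne_zero hV hne hx a
  have hnz' := fun a ↦ he'.secondForm_self_ne_zero hV hne hx' a
  have hl1 : ∀ a, lnForm g e' a x (e.l x) =
      -(k x * (secondForm g e a a x * coeffK g e a x)) := by
    intro a
    rw [hform' a _ (he.l_mem x hx), lnForm_l hV he.toIsAdapted hx a (hoff a) (hnz a),
      Finset.sum_eq_zero fun b _ ↦ by rw [he.val_cov_l_l_s hV hx, mul_zero]]
    ring
  have hs1 : ∀ a b, lnForm g e' a x (e.s b x) =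
      -(k x * (secondForm g e a a x * coeffKS g e a b x))
        + k x * secondForm g e a a x * (ε b * t b * secondForm g e b b x) := by
    intro a b
    rw [hform' a _ (he.s_mem x hx b), lnForm_s he.toIsAdapted hx hV a b (hoff a) (hnz a),
      Finset.sum_eq_single b (fun d _ hd ↦ by
        rw [show g.val x (leviCivita g e.l x (e.s b x)) (e.s d x) = secondForm g e d b x from rfl,
          hoff d b hd.symm, mul_zero]) (by simp)]
    simp only [secondForm]
    ring
  refine ⟨k x, ε, t, hc0, hε, hlk x ⟨hxO, hxV⟩, hs, fun a ↦ hsf' a x ⟨hxO, hxV⟩, fun a ↦ ?_,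
    fun a b ↦ ?_⟩
  · have h1 := lnForm_l hV he'.toIsAdapted hx' a (hoff' a) (hnz' a)
    rw [hlk x ⟨hxO, hxV⟩, lnForm_smul, hl1, hsf' a x ⟨hxO, hxV⟩] at h1
    have h2 := hnz a
    refine mul_left_cancel₀ (mul_ne_zero hc0 h2) ?_
    linear_combination h1
  · have h1 := lnForm_s he'.toIsAdapted hx' hV a b (hoff' a) (hnz' a)
    rw [hs b, lnForm_add, lnForm_smul, lnForm_smul, hl1, hs1, hsf' a x ⟨hxO, hxV⟩] at h1
    refine mul_left_cancel₀ (mul_ne_zero hc0 (hnz a)) ?_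
    linear_combination h1 - (k x * secondForm g e a a x * t b * secondForm g e b b x) * hε b

/-- The plane spanned by `e_2 + L_{a2} e_1` and `e_3 + L_{a3} e_1` does not depend on the
eigenframe. -/
lemma span_normalizingObject_eq (hV : IsSubmanifold 1 V) (hlam : IsEigenvaluePair g V lam)
    (hne : ∀ a, ∀ x ∈ V, ∀ l ∈ radical g V x, l ≠ 0 → lam a x l ≠ 0)
    (hdist : ∀ x ∈ V, ∀ l ∈ radical g V x, l ≠ 0 → lam 0 x l ≠ lam 1 x l)
    (hK : ∀ U e, IsEigenframe g V lam U e → ∀ x ∈ U ∩ V, ∀ a b,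
      coeffK g e a x ≠ lam b x (e.l x))
    (he : IsEigenframe g V lam U e) {U' : Set M} {e' : Frame M}
    (he' : IsEigenframe g V lam U' e') (hxU : x ∈ U) (hxU' : x ∈ U') (hxV : x ∈ V) (a : Fin 2) :
    Submodule.span ℝ (range fun b ↦ e'.s b x + normalizingObject g e' a b x • e'.l x) =
      Submodule.span ℝ (range fun b ↦ e.s b x + normalizingObject g e a b x • e.l x) := by
  obtain ⟨c, ε, t, hc, hε, hl, hs, hsf, hKa, hKab⟩ :=
    he.exists_change hV hlam hne hdist he' hxU hxU' hxV
  have key : ∀ b, e'.s b x + normalizingObject g e' a b x • e'.l x =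
      ε b • (e.s b x + normalizingObject g e a b x • e.l x) := by
    intro b
    have h0 : secondForm g e b b x - coeffK g e a x ≠ 0 := by
      rw [he.secondForm_self ⟨hxU, hxV⟩]
      exact sub_ne_zero.2 (hK U e he x ⟨hxU, hxV⟩ a b).symm
    -- The transformation law of `K_ab` divided by `λ_b - K_a`: the shift of `L_ab` compensates
    -- exactly the shift `t_b` of the screen vector.
    have h1 : t b + normalizingObject g e' a b x * c = ε b * normalizingObject g e a b x := by
      unfold normalizingObject
      rw [hKab, hKa, hsf, ← mul_sub]
      field_simp
      ring
    rw [hs b, hl, smul_smul, smul_add, smul_smul, ← h1, add_smul, add_assoc]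
  have hε0 : ∀ b, ε b ≠ 0 := fun b h ↦ by
    have := hε b
    rw [h, zero_mul] at this
    exact zero_ne_one this
  apply le_antisymm <;> rw [Submodule.span_le] <;> rintro _ ⟨b, rfl⟩
  · simp only [key]
    exact Submodule.smul_mem _ _ (Submodule.subset_span ⟨b, rfl⟩)
  · have : e.s b x + normalizingObject g e a b x • e.l x =
        ε b • (e'.s b x + normalizingObject g e' a b x • e'.l x) := by
      rw [key, smul_smul, hε, one_smul]
    simp only [this]
    exact Submodule.smul_mem _ _ (Submodule.subset_span ⟨b, rfl⟩)

end IsEigenframe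

end

/-! ### Normalizations determined by a screen -/

section

variable {g : LorentzMetric M} {U V W : Set M} {e : Frame M} {x : M} {J : M → ℝ}
  {lam : Fin 2 → (x : M) → TangentSpace (𝓡 4) x → ℝ}
  {S : (x : M) → Submodule ℝ (TangentSpace (𝓡 4) x)}

/-- The span of the isotropic vectors that are transversal to `V` and orthogonal to `S`. -/
def transversalOf (g : LorentzMetric M) (V : Set M)
    (S : (x : M) → Submodule ℝ (TangentSpace (𝓡 4) x)) (x : M) :
    Submodule ℝ (TangentSpace (𝓡 4) x) :=
  Submodule.span ℝ {v | g.val x v v = 0 ∧ (∀ w ∈ S x, g.val x v w = 0) ∧ v ∉ tangentSpaceOf V x}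

/-- The isotropic vector field normalized by `e₁` and orthogonal to the vectors `e_b + f_b e₁`. -/
def Frame.transversal (e : Frame M) (f : Fin 2 → M → ℝ) : VField M := fun y ↦
  e.n y + (f 0 y • e.s 0 y + f 1 y • e.s 1 y)
    + (1 / 2 * (f 0 y * f 0 y + f 1 y * f 1 y)) • e.l y

namespace IsAdapted

variable {f : Fin 2 → M → ℝ}

lemma smoothV_transversal (he : IsAdapted g V U e) (hf : ∀ b, SmoothF (f b) U) :
    SmoothV (e.transversal f) U :=
  SmoothV.add (SmoothV.add he.smooth_n (SmoothV.add (SmoothV.smul (hf 0) (he.smooth_s 0))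
    (SmoothV.smul (hf 1) (he.smooth_s 1)))) (SmoothV.smul (contMDiffOn_const.mul
      (((hf 0).mul (hf 0)).add ((hf 1).mul (hf 1)))) he.smooth_l)

lemma val_transversal_l (he : IsAdapted g V U e) (hx : x ∈ U ∩ V) :
    g.val x (e.transversal f x) (e.l x) = -1 := by
  simp [Frame.transversal, he.n_l hx, he.s_l hx, he.l_l x hx]

lemma val_transversal_screen (he : IsAdapted g V U e) (hx : x ∈ U ∩ V) (b : Fin 2) :
    g.val x (e.transversal f x) (e.s b x + f b x • e.l x) = 0 := by
  rw [map_add, map_smul, he.val_transversal_l hx]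
  fin_cases b <;> simp [Frame.transversal, he.n_s hx, he.s_s x hx, he.l_s x hx]

lemma val_transversal_self (he : IsAdapted g V U e) (hx : x ∈ U ∩ V) :
    g.val x (e.transversal f x) (e.transversal f x) = 0 := by
  simp [Frame.transversal, he.n_s hx, he.s_s x hx, he.l_s x hx, he.n_n x hx, he.s_n x hx,
    he.l_n x hx, he.l_l x hx, he.s_l hx, he.n_l hx]
  ring

/-- Orthogonality to the screen determines the `e_b`-components of a vector by its `e₄`-component,
and isotropy determines the `e₁`-component. The last step divides by `g(v, e₁)`, which is nonzero
because `v` is transversal. -/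
lemma transversalOf_eq (hV : IsSubmanifold 1 V) (he : IsAdapted g V U e) (hx : x ∈ U ∩ V)
    (hS : S x = Submodule.span ℝ (range fun b ↦ e.s b x + f b x • e.l x)) :
    transversalOf g V S x = Submodule.span ℝ {e.transversal f x} := by
  apply le_antisymm <;> refine Submodule.span_le.2 ?_
  · rintro v ⟨hv, hvS, hvT⟩
    rw [he.mem_tangent_iff hV hx] at hvT
    have hb : ∀ b, g.val x v (e.s b x) = -g.val x v (e.l x) * f b x := by
      intro b
      have := hvS (e.s b x + f b x • e.l x) (hS ▸ Submodule.subset_span ⟨b, rfl⟩)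
      rw [map_add, map_smul, smul_eq_mul] at this
      linarith
    have hexp := he.expand hx v
    have hα : -g.val x v (e.n x) =
        -g.val x v (e.l x) * (1 / 2 * (f 0 x * f 0 x + f 1 x * f 1 x)) := by
      -- Only the second argument is to be expanded, so the rewrite is undone in the first; the
      -- result is linear in the components of `v`.
      rw [hexp] at hv
      nth_rewrite 1 [← hexp] at hv
      simp only [map_add, map_smul, smul_eq_mul, Fin.sum_univ_two, hb] at hv
      refine mul_left_cancel₀ hvT ?_
      linear_combination 1 / 2 * hv
    rw [hexp, hα]
    simp only [hb, Fin.sum_univ_two]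
    refine Submodule.mem_span_singleton.2 ⟨-g.val x v (e.l x), ?_⟩
    simp only [Frame.transversal, smul_add, smul_smul]
    abel
  · rw [singleton_subset_iff]
    refine Submodule.subset_span ⟨he.val_transversal_self hx, fun w hw ↦ ?_, ?_⟩
    · rw [hS] at hw
      induction hw using Submodule.span_induction with
      | mem w hw => obtain ⟨b, rfl⟩ := hw; exact he.val_transversal_screen hx b
      | zero => exact map_zero _
      | add w w' _ _ h h' => rw [map_add, h, h', add_zero]
      | smul c w _ h => rw [map_smul, h, smul_zero]
    · rw [he.mem_tangent_iff hV hx, he.val_transversal_l hx]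
      norm_num

lemma val_screen_s (he : IsAdapted g V U e) (hx : x ∈ U ∩ V) (b d : Fin 2) :
    g.val x (e.s b x + f b x • e.l x) (e.s d x) = if b = d then 1 else 0 := by
  rw [map_add, map_smul, add_apply, smul_apply, he.s_s x hx, he.l_s x hx, smul_zero, add_zero]

lemma expand_screen (he : IsAdapted g V U e) (hx : x ∈ U ∩ V) {v : TangentSpace (𝓡 4) x}
    (hv : v ∈ Submodule.span ℝ (range fun b ↦ e.s b x + f b x • e.l x)) :
    v = ∑ b, g.val x v (e.s b x) • (e.s b x + f b x • e.l x) := by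
  obtain ⟨c, rfl⟩ := (Submodule.mem_span_range_iff_exists_fun ℝ).1 hv
  refine Finset.sum_congr rfl fun d _ ↦ ?_
  congr 1
  rw [map_sum, sum_apply]
  simp only [map_smul, smul_apply, he.val_screen_s hx, smul_eq_mul]
  simp

lemma finrank_screen (he : IsAdapted g V U e) (hx : x ∈ U ∩ V) :
    Module.finrank ℝ (Submodule.span ℝ (range fun b ↦ e.s b x + f b x • e.l x)) = 2 := by
  have hli : LinearIndependent ℝ fun b ↦ e.s b x + f b x • e.l x := by
    rw [Fintype.linearIndependent_iff]
    intro c hc d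
    have := congrArg (fun v ↦ g.val x v (e.s d x)) hc
    simp only [map_sum, sum_apply, map_smul, smul_apply, he.val_screen_s hx, smul_eq_mul, map_zero,
      zero_apply] at this
    simpa using this
  rw [finrank_span_eq_card hli, Fintype.card_fin]

end IsAdapted

/-- A field of planes in the tangent spaces of `V` spanned locally by fields `e_b + f_b e₁` with
smooth `f_b` is the screen of a normalization. -/
lemma isNormalization_of_local (hV : IsSubmanifold 1 V)
    (h : ∀ x ∈ V, ∃ (U : Set M) (e : Frame M) (f : Fin 2 → M → ℝ), x ∈ U ∧ IsAdapted g V U e ∧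
      (∀ b, SmoothF (f b) U) ∧
      ∀ y ∈ U ∩ V, S y = Submodule.span ℝ (range fun b ↦ e.s b y + f b y • e.l y)) :
    IsNormalization g V S (transversalOf g V S) where
  screen :=
    { smooth := by
        intro x hx
        obtain ⟨U, e, f, hxU, he, hf, hS⟩ := h x hx
        refine ⟨by rw [hS x ⟨hxU, hx⟩]; exact he.finrank_screen ⟨hxU, hx⟩, U, he.isOpen, hxU,
          fun b y ↦ e.s b y + f b y • e.l y, fun b ↦
            SmoothV.add (he.smooth_s b) (SmoothV.smul (hf b) he.smooth_l), hS⟩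
      inf_radical := by
        intro x hx
        obtain ⟨U, e, f, hxU, he, hf, hS⟩ := h x hx
        rw [eq_bot_iff]
        rintro v ⟨hv, hv'⟩
        rw [SetLike.mem_coe, hS x ⟨hxU, hx⟩] at hv
        rw [Submodule.mem_bot, he.expand_screen ⟨hxU, hx⟩ hv]
        exact Finset.sum_eq_zero fun b _ ↦ by
          rw [hv'.2 _ (he.s_mem x ⟨hxU, hx⟩ b), zero_smul]
      sup_radical := by
        intro x hx
        obtain ⟨U, e, f, hxU, he, hf, hS⟩ := h x hx
        apply le_antisymm
        · refine sup_le ?_ fun v hv ↦ hv.1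
          rw [hS x ⟨hxU, hx⟩, Submodule.span_le]
          rintro _ ⟨b, rfl⟩
          exact add_mem (he.s_mem x ⟨hxU, hx⟩ b) (Submodule.smul_mem _ _ (he.l_mem x ⟨hxU, hx⟩))
        · intro v hv
          have hl : ∀ c : ℝ, c • e.l x ∈ S x ⊔ radical g V x := fun c ↦
            Submodule.mem_sup_right (Submodule.smul_mem _ _ (he.l_mem_radical hV ⟨hxU, hx⟩))
          have hs : ∀ b, e.s b x ∈ S x ⊔ radical g V x := by
            intro b
            have h1 : e.s b x + f b x • e.l x ∈ S x ⊔ radical g V x :=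
              Submodule.mem_sup_left (hS x ⟨hxU, hx⟩ ▸ Submodule.subset_span ⟨b, rfl⟩)
            simpa using sub_mem h1 (hl (f b x))
          rw [he.expand_tangent hV ⟨hxU, hx⟩ hv]
          exact add_mem (hl _) (Submodule.sum_mem _ fun b _ ↦ Submodule.smul_mem _ _ (hs b)) }
  smooth := by
    intro x hx
    obtain ⟨U, e, f, hxU, he, hf, hS⟩ := h x hx
    refine ⟨?_, U, he.isOpen, hxU, fun _ ↦ e.transversal f, fun _ ↦ he.smoothV_transversal hf,
      fun y hy ↦ ?_⟩
    · rw [he.transversalOf_eq hV ⟨hxU, hx⟩ (hS x ⟨hxU, hx⟩)]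
      refine finrank_span_singleton fun h0 ↦ ?_
      have := he.val_transversal_l (f := f) ⟨hxU, hx⟩
      rw [h0, map_zero, zero_apply] at this
      norm_num at this
    · rw [he.transversalOf_eq hV hy (hS y hy), range_const]
  isotropic := by
    intro x hx v hv
    obtain ⟨U, e, f, hxU, he, hf, hS⟩ := h x hx
    rw [he.transversalOf_eq hV ⟨hxU, hx⟩ (hS x ⟨hxU, hx⟩)] at hv
    obtain ⟨c, rfl⟩ := Submodule.mem_span_singleton.1 hv
    rw [map_smul, map_smul, smul_apply, he.val_transversal_self ⟨hxU, hx⟩, smul_zero, smul_zero]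
  transversal := by
    intro x hx
    obtain ⟨U, e, f, hxU, he, hf, hS⟩ := h x hx
    rw [he.transversalOf_eq hV ⟨hxU, hx⟩ (hS x ⟨hxU, hx⟩), eq_bot_iff]
    rintro v ⟨hv, hv'⟩
    obtain ⟨c, rfl⟩ := Submodule.mem_span_singleton.1 hv
    rw [SetLike.mem_coe, he.mem_tangent_iff hV ⟨hxU, hx⟩, map_smul, smul_apply,
      he.val_transversal_l ⟨hxU, hx⟩, smul_eq_mul] at hv'
    rw [Submodule.mem_bot, show c = 0 by linarith, zero_smul]
  orthogonal := by
    intro x hx v hv w hw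
    obtain ⟨U, e, f, hxU, he, hf, hS⟩ := h x hx
    rw [he.transversalOf_eq hV ⟨hxU, hx⟩ (hS x ⟨hxU, hx⟩)] at hv
    obtain ⟨c, rfl⟩ := Submodule.mem_span_singleton.1 hv
    rw [hS x ⟨hxU, hx⟩] at hw
    obtain ⟨d, rfl⟩ := (Submodule.mem_span_range_iff_exists_fun ℝ).1 hw
    rw [map_sum]
    refine Finset.sum_eq_zero fun b _ ↦ ?_
    rw [map_smul, map_smul, smul_apply, he.val_transversal_screen ⟨hxU, hx⟩, smul_zero, smul_zero]

/-! ### The screens given by the normalizing objects -/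

/-- The plane spanned by `e_b + L_ab e₁` in all eigenframes. -/
def normalizingScreen (g : LorentzMetric M) (V : Set M)
    (lam : Fin 2 → (x : M) → TangentSpace (𝓡 4) x → ℝ) (a : Fin 2) (x : M) :
    Submodule ℝ (TangentSpace (𝓡 4) x) :=
  ⨅ p : {p : Set M × Frame M // IsEigenframe g V lam p.1 p.2 ∧ x ∈ p.1},
    Submodule.span ℝ (range fun b ↦ p.1.2.s b x + normalizingObject g p.1.2 a b x • p.1.2.l x)

/-- The planes over which the infimum is taken all coincide at a point of `V`, so the frame-free
definition agrees with each of them. -/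
lemma normalizingScreen_eq (hV : IsSubmanifold 1 V) (hlam : IsEigenvaluePair g V lam)
    (hne : ∀ a, ∀ x ∈ V, ∀ l ∈ radical g V x, l ≠ 0 → lam a x l ≠ 0)
    (hdist : ∀ x ∈ V, ∀ l ∈ radical g V x, l ≠ 0 → lam 0 x l ≠ lam 1 x l)
    (hK : ∀ U e, IsEigenframe g V lam U e → ∀ x ∈ U ∩ V, ∀ a b,
      coeffK g e a x ≠ lam b x (e.l x))
    (he : IsEigenframe g V lam U e) (hx : x ∈ U ∩ V) (a : Fin 2) :
    normalizingScreen g V lam a x =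
      Submodule.span ℝ (range fun b ↦ e.s b x + normalizingObject g e a b x • e.l x) := by
  refine le_antisymm (iInf_le_of_le ⟨(U, e), he, hx.1⟩ le_rfl) (le_iInf fun p ↦ ?_)
  exact (he.span_normalizingObject_eq hV hlam hne hdist hK p.2.1 hx.1 p.2.2 hx.2 a).ge

lemma IsAdapted.smoothF_mu (he : IsAdapted g V U e) (a b c : Fin 2) :
    SmoothF (mu g e a b c) U := by
  have hω : ∀ i j, SmoothF (fun y ↦ omegaS g e i j y (e.s c y)) U := fun i j ↦
    SmoothF.val (SmoothV.leviCivita (he.smooth_s i) (he.smooth_s c) he.isOpen) (he.smooth_s j)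
  have hωl : SmoothF (fun y ↦ omegaL g e y (e.s c y)) U :=
    (SmoothF.val (SmoothV.leviCivita he.smooth_l (he.smooth_s c) he.isOpen) he.smooth_n).neg
  have hs := fun i j ↦ he.smoothF_secondForm i j
  exact (((SmoothF.mvfderiv (hs a b) (he.smooth_s c) he.isOpen).sub
    (SmoothF.sum fun d _ ↦ (hs a d).mul (hω b d))).sub
    (SmoothF.sum fun d _ ↦ (hs d b).mul (hω a d))).sub ((hs a b).mul hωl)

lemma IsAdapted.smoothF_curv (he : IsAdapted g V U e) (a : Fin 2) : SmoothF (curv g e a) U :=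
  SmoothF.val (SmoothV.curvature (he.smooth_s a) he.smooth_l (he.smooth_s a) he.isOpen) he.smooth_l

/-- The denominators `λ_a` and `λ_b - K_a` are known to be nonzero only along `V`, so the domain is
shrunk to where they do not vanish. -/
lemma IsEigenframe.exists_smoothF_normalizingObject (hV : IsSubmanifold 1 V)
    (hne : ∀ a, ∀ x ∈ V, ∀ l ∈ radical g V x, l ≠ 0 → lam a x l ≠ 0)
    (hK : ∀ U e, IsEigenframe g V lam U e → ∀ x ∈ U ∩ V, ∀ a b,
      coeffK g e a x ≠ lam b x (e.l x))
    (he : IsEigenframe g V lam U e) (hx : x ∈ U ∩ V) (a b : Fin 2) :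
    ∃ U' ⊆ U, IsOpen U' ∧ x ∈ U' ∧ SmoothF (normalizingObject g e a b) U' := by
  have hO₁ := SmoothF.isOpen_ne (he.smoothF_secondForm a a) he.isOpen
  set O₁ := {y ∈ U | secondForm g e a a y ≠ 0}
  have hsub : O₁ ⊆ U := fun y hy ↦ hy.1
  have hs := (he.smoothF_secondForm a a).mono hsub
  have hcK : SmoothF (coeffK g e a) O₁ :=
    hs.sub (SmoothF.div ((he.smoothF_curv a).mono hsub) hs fun y hy ↦ hy.2)
  have hcKS : SmoothF (coeffKS g e a b) O₁ :=
    (SmoothF.div ((he.smoothF_mu a a b).mono hsub) hs fun y hy ↦ hy.2).neg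
  have hden : SmoothF (fun y ↦ secondForm g e b b y - coeffK g e a y) O₁ :=
    ((he.smoothF_secondForm b b).mono hsub).sub hcK
  have hsub₂ : {y ∈ O₁ | secondForm g e b b y - coeffK g e a y ≠ 0} ⊆ O₁ := fun y hy ↦ hy.1
  refine ⟨_, hsub₂.trans hsub, SmoothF.isOpen_ne hden hO₁,
    ⟨⟨hx.1, he.secondForm_self_ne_zero hV hne hx a⟩, ?_⟩,
    SmoothF.div (hcKS.mono hsub₂) (hden.mono hsub₂) fun y hy ↦ hy.2⟩
  rw [he.secondForm_self hx]
  exact sub_ne_zero.2 (hK U e he x hx a b).symm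

/-! ### The screen given by the ratio of the eigenvalues -/

/-- `J` is a smooth function on the open set `U` that extends `λ₂ / λ₃`. -/
structure IsEigenvalueRatio (g : LorentzMetric M) (V : Set M)
    (lam : Fin 2 → (x : M) → TangentSpace (𝓡 4) x → ℝ) (U : Set M) (J : M → ℝ) : Prop where
  isOpen : IsOpen U
  smooth : SmoothF J U
  eq_div : ∀ x ∈ U ∩ V, ∀ l ∈ radical g V x, l ≠ 0 → J x = lam 0 x l / lam 1 x l

/-- The kernel of `d(λ₂ / λ₃)` on the tangent spaces of `V`. -/
def ratioScreen (g : LorentzMetric M) (V : Set M)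
    (lam : Fin 2 → (x : M) → TangentSpace (𝓡 4) x → ℝ) (x : M) :
    Submodule ℝ (TangentSpace (𝓡 4) x) where
  carrier := {v | v ∈ tangentSpaceOf V x ∧ ∀ U J, IsEigenvalueRatio g V lam U J → x ∈ U →
    mvfderiv (𝓡 4) J x v = 0}
  add_mem' := fun hv hw ↦ ⟨add_mem hv.1 hw.1, fun U J hJ hx ↦ by
    rw [map_add, hv.2 U J hJ hx, hw.2 U J hJ hx, add_zero]⟩
  zero_mem' := ⟨zero_mem _, fun _ _ _ _ ↦ map_zero _⟩
  smul_mem' := fun c v hv ↦ ⟨Submodule.smul_mem _ c hv.1, fun U J hJ hx ↦ by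
    rw [map_smul, hv.2 U J hJ hx, smul_zero]⟩

/-- Two extensions of the ratio agree on `V`, hence have the same derivatives in tangent directions,
and a single extension decides membership. -/
lemma IsEigenvalueRatio.mem_ratioScreen_iff (hV : IsLightlikeHypersurface g V)
    (hJ : IsEigenvalueRatio g V lam U J) (hx : x ∈ U ∩ V) (v : TangentSpace (𝓡 4) x) :
    v ∈ ratioScreen g V lam x ↔ v ∈ tangentSpaceOf V x ∧ mvfderiv (𝓡 4) J x v = 0 := by
  refine ⟨fun hv ↦ ⟨hv.1, hv.2 U J hJ hx.1⟩, fun hv ↦ ⟨hv.1, fun U' J' hJ' hx' ↦ ?_⟩⟩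
  rw [← hv.2]
  refine mvfderiv_congr_of_tangent (hJ.isOpen.inter hJ'.isOpen) (hJ'.smooth.mono inter_subset_right)
    (hJ.smooth.mono inter_subset_left) (fun y hy ↦ ?_) ⟨hx.1, hx'⟩ hv.1
  obtain ⟨l, hl, hl0⟩ := Submodule.exists_mem_ne_zero_of_ne_bot (hV.degenerate y hy.2)
  rw [hJ.eq_div y ⟨hy.1.1, hy.2⟩ l hl hl0, hJ'.eq_div y ⟨hy.1.2, hy.2⟩ l hl hl0]

/-- The derivative of the ratio of the eigenvalues in the isotropic direction. -/
lemma IsEigenvalueRatio.mvfderiv_l_ne_zero (hV : IsSubmanifold 1 V)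
    (hne : ∀ a, ∀ x ∈ V, ∀ l ∈ radical g V x, l ≠ 0 → lam a x l ≠ 0)
    (hK' : ∀ U e, IsEigenframe g V lam U e → ∀ x ∈ U ∩ V, coeffK g e 0 x ≠ coeffK g e 1 x)
    (he : IsEigenframe g V lam U e) (hJ : IsEigenvalueRatio g V lam U J) (hx : x ∈ U ∩ V) :
    mvfderiv (𝓡 4) J x (e.l x) ≠ 0 := by
  have hs := fun a ↦ he.smoothF_secondForm a a
  have hnz := fun a ↦ he.secondForm_self_ne_zero hV hne hx a
  -- Differentiating `λ₂ = J λ₃` along `e₁` with `e₁(λ_a) = λ_a (ω₁¹(e₁) - K_a)`, the connection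
  -- form cancels. If `dJ(e₁)` vanished, this would force `K₂ = K₃`.
  have hprod : ∀ y ∈ U ∩ V, secondForm g e 0 0 y = J y * secondForm g e 1 1 y := by
    intro y hy
    have h1 := he.secondForm_self_ne_zero hV hne hy 1
    rw [he.secondForm_self hy] at h1
    rw [hJ.eq_div y hy _ (he.l_mem_radical hV hy) (he.l_ne_zero hy), he.secondForm_self hy,
      he.secondForm_self hy, div_mul_cancel₀ _ h1]
  have hd := mvfderiv_congr_of_tangent he.isOpen (hs 0) (hJ.smooth.mul (hs 1)) hprod hx.1
    (he.l_mem x hx)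
  have hm := congrArg (fun A : TangentSpace (𝓡 4) x →L[ℝ] ℝ ↦ A (e.l x))
    (mvfderiv_mul (SmoothF.mdiff hJ.smooth he.isOpen hx.1) (SmoothF.mdiff (hs 1) he.isOpen hx.1))
  have h0 := lnForm_l hV he.toIsAdapted hx 0 (fun b hb ↦ he.secondForm_of_ne hx hb.symm) (hnz 0)
  have h1 := lnForm_l hV he.toIsAdapted hx 1 (fun b hb ↦ he.secondForm_of_ne hx hb.symm) (hnz 1)
  have hm' : mvfderiv (𝓡 4) (J * secondForm g e 1 1) x (e.l x) =
      J x * mvfderiv (𝓡 4) (secondForm g e 1 1) x (e.l x)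
        + secondForm g e 1 1 x * mvfderiv (𝓡 4) J x (e.l x) := hm
  have hd' : mvfderiv (𝓡 4) (secondForm g e 0 0) x (e.l x) =
      J x * mvfderiv (𝓡 4) (secondForm g e 1 1) x (e.l x)
        + secondForm g e 1 1 x * mvfderiv (𝓡 4) J x (e.l x) := hd.trans hm'
  intro hz
  unfold lnForm at h0 h1
  rw [hz, mul_zero, add_zero] at hd'
  refine hK' U e he x hx (mul_left_cancel₀ (hnz 0) ?_)
  linear_combination h0 - hd' - J x * h1 + (omegaL g e x (e.l x) - coeffK g e 1 x) * hprod x hx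

/-- Near each point the ratio of the eigenvalues extends to a smooth function, with nonvanishing
derivative in the isotropic direction. -/
lemma IsLightlikeHypersurface.exists_isEigenvalueRatio (hV : IsLightlikeHypersurface g V)
    (hlam : IsEigenvaluePair g V lam)
    (hne : ∀ a, ∀ x ∈ V, ∀ l ∈ radical g V x, l ≠ 0 → lam a x l ≠ 0)
    (hdist : ∀ x ∈ V, ∀ l ∈ radical g V x, l ≠ 0 → lam 0 x l ≠ lam 1 x l)
    (hK' : ∀ U e, IsEigenframe g V lam U e → ∀ x ∈ U ∩ V, coeffK g e 0 x ≠ coeffK g e 1 x)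
    (hx : x ∈ V) :
    ∃ U e J, x ∈ U ∧ IsEigenframe g V lam U e ∧ IsEigenvalueRatio g V lam U J ∧
      ∀ y ∈ U, mvfderiv (𝓡 4) J y (e.l y) ≠ 0 := by
  obtain ⟨U, e, hxU, he⟩ := hV.exists_isEigenframe hlam hdist hx
  have hs := fun a ↦ he.smoothF_secondForm a a
  have hO₁ := SmoothF.isOpen_ne (hs 1) he.isOpen
  set O₁ := {y ∈ U | secondForm g e 1 1 y ≠ 0}
  have hsub : O₁ ⊆ U := fun y hy ↦ hy.1
  have he₁ := he.mono hO₁ hsub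
  let J : M → ℝ := fun y ↦ secondForm g e 0 0 y / secondForm g e 1 1 y
  have hJ : IsEigenvalueRatio g V lam O₁ J := by
    refine ⟨hO₁, SmoothF.div ((hs 0).mono hsub) ((hs 1).mono hsub) fun y hy ↦ hy.2,
      fun y hy l hl hl0 ↦ ?_⟩
    -- The isotropic vectors are the multiples of `e₁`, and the quotient of two quantities of weight
    -- one does not see the factor.
    have hlr := hl
    rw [he₁.radical_eq hV.submanifold hy] at hlr
    obtain ⟨c, rfl⟩ := Submodule.mem_span_singleton.1 hlr
    have hc : c ≠ 0 := fun h ↦ hl0 (by rw [h, zero_smul])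
    have hr := he₁.l_mem_radical hV.submanifold hy
    simp only [J]
    rw [hlam.smul 0 y hy.2 _ hr, hlam.smul 1 y hy.2 _ hr, mul_div_mul_left _ _ hc,
      he₁.secondForm_self hy, he₁.secondForm_self hy]
  have hdJ := SmoothF.mvfderiv hJ.smooth he₁.smooth_l hO₁
  have hO₂ := SmoothF.isOpen_ne hdJ hO₁
  have hxO₁ : x ∈ O₁ := ⟨hxU, he.secondForm_self_ne_zero hV.submanifold hne ⟨hxU, hx⟩ 1⟩
  refine ⟨{y ∈ O₁ | mvfderiv (𝓡 4) J y (e.l y) ≠ 0}, e, J, ⟨hxO₁, hJ.mvfderiv_l_ne_zero hV.submanifold hne hK' he₁ ⟨hxO₁, hx⟩⟩,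
    he₁.mono hO₂ fun y hy ↦ hy.1, ⟨hO₂, hJ.smooth.mono fun y hy ↦ hy.1, fun y hy ↦
      hJ.eq_div y ⟨hy.1.1, hy.2⟩⟩, fun y hy ↦ hy.2⟩

/-- Since `dJ(e₁) ≠ 0`, the condition `dJ(e_b + f_b e₁) = 0` has exactly one solution `f_b`; this
puts the kernel in the form required for a screen. -/
lemma IsEigenvalueRatio.ratioScreen_eq (hV : IsLightlikeHypersurface g V)
    (he : IsEigenframe g V lam U e) (hJ : IsEigenvalueRatio g V lam U J) (hx : x ∈ U ∩ V)
    (h0 : mvfderiv (𝓡 4) J x (e.l x) ≠ 0) :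
    ratioScreen g V lam x = Submodule.span ℝ (range fun b ↦ e.s b x +
      (-(mvfderiv (𝓡 4) J x (e.s b x) / mvfderiv (𝓡 4) J x (e.l x))) • e.l x) := by
  apply le_antisymm
  · intro v hv
    rw [hJ.mem_ratioScreen_iff hV hx] at hv
    have hexp := he.expand_tangent hV.submanifold hx hv.1
    have hdv := hv.2
    rw [hexp, map_add, map_smul, map_sum, smul_eq_mul] at hdv
    simp only [map_smul, smul_eq_mul] at hdv
    have hα : -g.val x v (e.n x) = ∑ b, g.val x v (e.s b x) *
        -(mvfderiv (𝓡 4) J x (e.s b x) / mvfderiv (𝓡 4) J x (e.l x)) := by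
      refine mul_right_cancel₀ h0 ?_
      rw [Finset.sum_mul, eq_neg_of_add_eq_zero_left hdv, ← Finset.sum_neg_distrib]
      refine Finset.sum_congr rfl fun b _ ↦ ?_
      field_simp
    rw [hexp, hα, Finset.sum_smul, ← Finset.sum_add_distrib]
    refine Submodule.sum_mem _ fun b _ ↦ ?_
    rw [mul_smul, ← smul_add, add_comm]
    exact Submodule.smul_mem _ _ (Submodule.subset_span ⟨b, rfl⟩)
  · rw [Submodule.span_le]
    rintro _ ⟨b, rfl⟩
    rw [SetLike.mem_coe, hJ.mem_ratioScreen_iff hV hx]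
    refine ⟨add_mem (he.s_mem x hx b) (Submodule.smul_mem _ _ (he.l_mem x hx)), ?_⟩
    rw [map_add, map_smul, smul_eq_mul]
    field_simp
    ring

/-- The level surfaces of the ratio of the eigenvalues are integral surfaces of the screen. -/
lemma isIntegrableOn_ratioScreen (hV : IsLightlikeHypersurface g V)
    (h : ∀ x ∈ V, ∃ U e J, x ∈ U ∧ IsEigenframe g V lam U e ∧ IsEigenvalueRatio g V lam U J ∧
      ∀ y ∈ U, mvfderiv (𝓡 4) J y (e.l y) ≠ 0) :
    IsIntegrableOn V (ratioScreen g V lam) := by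
  intro x hx
  obtain ⟨U, e, J, hxU, he, hJ, hJl⟩ := h x hx
  obtain ⟨U₀, F, hU₀, hxU₀, hF, hVF, hT⟩ := hV.submanifold.exists_equation hx
  have hO := hU₀.inter he.isOpen
  let W : Set M := {y | y ∈ U₀ ∩ U ∧ y ∈ V ∧ J y = J x}
  let Φ : M → Fin 2 → ℝ := fun y ↦ ![F y, J y - J x]
  have hJc : SmoothF (fun y ↦ J y - J x) (U₀ ∩ U) :=
    (hJ.smooth.mono inter_subset_right).sub contMDiffOn_const
  have hFO : SmoothF F (U₀ ∩ U) := hF.mono inter_subset_left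
  have hΦ : ContMDiffOn (𝓡 4) 𝓘(ℝ, Fin 2 → ℝ) ∞ Φ (U₀ ∩ U) := by
    rw [contMDiffOn_pi_space]
    intro i
    fin_cases i
    · exact hFO
    · exact hJc
  have hW : ∀ y ∈ U₀ ∩ U, y ∈ W ↔ Φ y = 0 := by
    intro y hy
    have : Φ y = 0 ↔ F y = 0 ∧ J y - J x = 0 := by
      rw [funext_iff, Fin.forall_fin_two]; rfl
    rw [this, ← hVF y hy.1, sub_eq_zero]
    exact ⟨fun h ↦ h.2, fun h ↦ ⟨hy, h⟩⟩
  have hdJ : ∀ y ∈ U₀ ∩ U, ∀ v : TangentSpace (𝓡 4) y,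
      mvfderiv (𝓡 4) (fun y ↦ J y - J x) y v = mvfderiv (𝓡 4) J y v := by
    intro y hy v
    have h1 := mvfderiv_sub (SmoothF.mdiff hJ.smooth he.isOpen hy.2)
      (mdifferentiableAt_const (I := 𝓡 4) (I' := 𝓘(ℝ)) (c := J x) (x := y))
    have h2 := congrArg (fun A : TangentSpace (𝓡 4) y →L[ℝ] ℝ ↦ A v) h1
    rw [mvfderiv_const, sub_zero] at h2
    exact h2
  have hdΦ : ∀ y ∈ U₀ ∩ U, ∀ v : TangentSpace (𝓡 4) y,
      mvfderiv (𝓡 4) Φ y v 0 = mvfderiv (𝓡 4) F y v ∧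
      mvfderiv (𝓡 4) Φ y v 1 = mvfderiv (𝓡 4) J y v := by
    intro y hy v
    have hd := (hΦ.contMDiffAt (hO.mem_nhds hy)).mdifferentiableAt (by simp)
    rw [← mvfderiv_component hd, ← mvfderiv_component hd, ← hdJ y hy]
    exact ⟨rfl, rfl⟩
  have hsurj : ∀ y ∈ W, Function.Surjective (mvfderiv (𝓡 4) Φ y) := by
    intro y hy p
    obtain ⟨v₀, hv₀⟩ := (hT y ⟨hy.1.1, hy.2.1⟩).1
    have hl0 := hJl y hy.1.2
    have hFl : mvfderiv (𝓡 4) F y (e.l y) = 0 :=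
      ((hT y ⟨hy.1.1, hy.2.1⟩).2 _).1 (he.l_mem y ⟨hy.1.2, hy.2.1⟩)
    -- The first coordinate is reached with the transversal vector `v₀`. The second is then
    -- corrected along `e₁`, on which `dF` vanishes and `dJ` does not.
    refine ⟨(p 0 / mvfderiv (𝓡 4) F y v₀) • v₀ + ((p 1 - p 0 / mvfderiv (𝓡 4) F y v₀ *
      mvfderiv (𝓡 4) J y v₀) / mvfderiv (𝓡 4) J y (e.l y)) • e.l y, ?_⟩
    ext i
    fin_cases i
    · change mvfderiv (𝓡 4) Φ y _ 0 = p 0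
      rw [(hdΦ y hy.1 _).1, map_add, map_smul, map_smul, hFl, smul_zero, add_zero, smul_eq_mul,
        div_mul_cancel₀ _ hv₀]
    · change mvfderiv (𝓡 4) Φ y _ 1 = p 1
      rw [(hdΦ y hy.1 _).2, map_add, map_smul, map_smul, smul_eq_mul, smul_eq_mul,
        div_mul_cancel₀ _ hl0]
      ring
  refine ⟨W, fun y hy ↦ hy.2.1, ⟨⟨hxU₀, hxU⟩, hx, rfl⟩, fun y hy ↦ ⟨U₀ ∩ U, hO, hy.1, Φ, hΦ, hW,
    fun z hz ↦ hsurj z hz.2⟩, fun y hy ↦ ?_⟩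
  ext v
  rw [mem_tangentSpaceOf_iff hO hΦ hW (hsurj y hy) hy.1 hy,
    hJ.mem_ratioScreen_iff hV ⟨hy.1.2, hy.2.1⟩, (hT y ⟨hy.1.1, hy.2.1⟩).2, funext_iff,
    Fin.forall_fin_two, (hdΦ y hy.1 v).1, (hdΦ y hy.1 v).2]
  rfl

end

end LightlikeGeometry

end

theorem theorem14 {M : Type*} [TopologicalSpace M] [ChartedSpace R4 M] [IsManifold (𝓡 4) ∞ M]
    (g : LorentzMetric M) (V : Set M) (hV : IsLightlikeHypersurface g V)
    (lam : Fin 2 → (x : M) → TangentSpace (𝓡 4) x → ℝ) (hlam : IsEigenvaluePair g V lam)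
    (hne : ∀ a, ∀ x ∈ V, ∀ l ∈ radical g V x, l ≠ 0 → lam a x l ≠ 0)
    (hdist : ∀ x ∈ V, ∀ l ∈ radical g V x, l ≠ 0 → lam 0 x l ≠ lam 1 x l)
    (hK : ∀ U e, IsEigenframe g V lam U e → ∀ x ∈ U ∩ V, ∀ a b,
      coeffK g e a x ≠ lam b x (e.l x))
    (hK' : ∀ U e, IsEigenframe g V lam U e → ∀ x ∈ U ∩ V, coeffK g e 0 x ≠ coeffK g e 1 x) :
    ∃ (S N : Fin 2 → (x : M) → Submodule ℝ (TangentSpace (𝓡 4) x))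
      (S' N' : (x : M) → Submodule ℝ (TangentSpace (𝓡 4) x)),
      (∀ a, IsNormalization g V (S a) (N a)) ∧
      (∀ a, ∀ U e, IsEigenframe g V lam U e → ∀ x ∈ U ∩ V,
        S a x = Submodule.span ℝ
          (Set.range fun b ↦ e.s b x + normalizingObject g e a b x • e.l x)) ∧
      IsNormalization g V S' N' ∧
      (∀ (U : Set M) (J : M → ℝ), IsOpen U → ContMDiffOn (𝓡 4) 𝓘(ℝ) ∞ J U →
        (∀ x ∈ U ∩ V, ∀ l ∈ radical g V x, l ≠ 0 → J x = lam 0 x l / lam 1 x l) →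
        ∀ x ∈ U ∩ V, ∀ v, v ∈ S' x ↔ v ∈ tangentSpaceOf V x ∧ mvfderiv (𝓡 4) J x v = 0) ∧
      IsIntegrableOn V S' := by
  have hVs := hV.submanifold
  have hratio : ∀ x ∈ V, ∃ U e J, x ∈ U ∧ IsEigenframe g V lam U e ∧
      IsEigenvalueRatio g V lam U J ∧ ∀ y ∈ U, mvfderiv (𝓡 4) J y (e.l y) ≠ 0 := fun x hx ↦
    hV.exists_isEigenvalueRatio hlam hne hdist hK' hx
  refine ⟨normalizingScreen g V lam, fun a ↦ transversalOf g V (normalizingScreen g V lam a),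
    ratioScreen g V lam, transversalOf g V (ratioScreen g V lam), fun a ↦ ?_,
    fun a U e he x hx ↦ normalizingScreen_eq hVs hlam hne hdist hK he hx a, ?_,
    fun U J hU hJ hJV x hx v ↦ IsEigenvalueRatio.mem_ratioScreen_iff hV ⟨hU, hJ, hJV⟩ hx v,
    isIntegrableOn_ratioScreen hV hratio⟩
  · refine isNormalization_of_local hVs fun x hx ↦ ?_
    obtain ⟨U, e, hxU, he⟩ := hV.exists_isEigenframe hlam hdist hx
    -- The neighbourhoods on which `L_a2` and `L_a3` are smooth may differ, and the frame is
    -- restricted to their intersection.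
    choose O hOU hO hxO hf using
      fun b ↦ he.exists_smoothF_normalizingObject hVs hne hK ⟨hxU, hx⟩ a b
    have hsub : O 0 ∩ O 1 ⊆ U := inter_subset_left.trans (hOU 0)
    have he' := he.mono ((hO 0).inter (hO 1)) hsub
    refine ⟨O 0 ∩ O 1, e, normalizingObject g e a, ⟨hxO 0, hxO 1⟩, he'.toIsAdapted, fun b ↦ ?_,
      fun y hy ↦ normalizingScreen_eq hVs hlam hne hdist hK he' hy a⟩
    fin_cases b
    · exact (hf 0).mono inter_subset_left
    · exact (hf 1).mono inter_subset_right
  · refine isNormalization_of_local hVs fun x hx ↦ ?_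
    obtain ⟨U, e, J, hxU, he, hJ, hJl⟩ := hratio x hx
    exact ⟨U, e, fun b y ↦ -(mvfderiv (𝓡 4) J y (e.s b y) / mvfderiv (𝓡 4) J y (e.l y)), hxU,
      he.toIsAdapted, fun b ↦ (SmoothF.div (SmoothF.mvfderiv hJ.smooth (he.smooth_s b) he.isOpen)
        (SmoothF.mvfderiv hJ.smooth he.smooth_l he.isOpen) hJl).neg,
      fun y hy ↦ hJ.ratioScreen_eq hV he hy (hJl y hy.1)⟩
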